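/- Let $M$ be a compact smooth Riemannian manifold (without boundary) of dimension $m\ge 1$, with distance $d$ (infinite between different components), open balls $B_r(x)=\{y: d(x,y)<r\}$ in $M$, and $\mathbb B_r(o_x)=\{v\in T_xM:\|v\|<r\}$. Write $\operatorname{inj}(M)=\inf_{x}\operatorname{inj}_x(M)$ for the injectivity radius, where $\operatorname{inj}_x(M)$ is the supremum of all $r>0$ for which $\exp_x|_{\mathbb B_r(o_x)}$ is a diffeomorphism onto its image. Call $r>0$ an admissible radius at $x$ if (a) $B_r(x)$ is strongly convex, i.e. any two points of its closure are joined by a unique minimal geodesic segment, whose interior lies in $B_r(x)$ if the two points are distinct, and (b) $\exp_x:\mathbb B_r(o_x)\to B_r(x)$ is a diffeomorphism. If $x,y$ are joined by a unique minimal geodesic segment, let $\tau^x_y:T_xM\to T_yM$ be the parallel translation along it. Let $F:M\to\mathbb R$ be a Lipschitz function. For $p\in M$ choose an admissible radius $r$ at $p$ and a set $E_F\subset M$ of Lebesgue measure zero such that $F$ is differentiable at every point of $B_r(p)\setminus E_F$. Let $K_F(p)$ be the set of all linear maps $G:T_pM\to\mathbb R$ of the form $G=\lim_{i\to\infty} dF_{x_i}\circ\tau^p_{x_i}$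 with $x_i\in B_r(p)\setminus E_F$ and $x_i\to p$, and let $\partial F(p)$ be the convex hull of $K_F(p)$. The point $p$ is nonsingular for $F$ (in the sense of Clarke) if, for such a choice, every $g\in\partial F(p)$ has maximal rank $\min\{m,1\}$. Global smooth approximation: choose finitely many points $p_1,\dots,p_k\in M$ with admissible radii $r_i<\operatorname{inj}(M)/2$ at $p_i$ such that $M=\bigcup_i B_{r_i}(p_i)$, and a smooth partition of unity $\{\psi_i\}_{i=1}^k$ with $\operatorname{supp}\psi_i\subset B_{r_i}(p_i)$. On the Euclidean space $T_{p_i}M$ let $\rho^{(i)}(y)=\alpha e^{-1/(1-\|y\|^2)}$ for $\|y\|<1$ and $\rho^{(i)}(y)=0$ otherwise, with $\alpha$ such that $\int\rho^{(i)}=1$, and $\rho^{(i)}_\varepsilon(y)=\rho^{(i)}(y/\varepsilon)/\varepsilon^m$. For $0<\varepsilon<\operatorname{inj}(M)/2$ put $$\widetilde F_\varepsilon(q)=\sum_{i=1}^k\psi_i(q)\int_{T_{p_i}M}\rho^{(i)}_\varepsilon(y)\,F\bigl(\exp_{p_i}(\exp_{p_i}^{-1}q-y)\bigr)\,dy,\qquad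 q\in M,$$ where $\exp_{p_i}^{-1}$ denotes the inverse of $\exp_{p_i}:\mathbb B_{r_i}(o_{p_i})\to B_{r_i}(p_i)$ (the $i$-th term is $0$ for $q\notin B_{r_i}(p_i)$). **Claim.** If $p\in M$ is nonsingular for $F$ in the sense of Clarke, then there is a constant $\lambda(p)>0$ such that, for every choice of the points $p_i$, the radii $r_i$ and the partition of unity $\{\psi_i\}$ as above, there is a constant $\varepsilon_0(p)\in(0,\operatorname{inj}(M)/2]$ such that for all $\varepsilon\in(0,\varepsilon_0(p))$ the gradient satisfies $\operatorname{grad}\widetilde F_\varepsilon\neq 0$ at every point of $B_{\lambda(p)}(p)$. In particular $\widetilde F_\varepsilon$ has no critical points on $B_{\lambda(p)}(p)$. -/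

import Mathlib

open Set Filter Topology MeasureTheory Bundle
open scoped Manifold ContDiff ENNReal NNReal

noncomputable section

namespace LipApprox

section Curves

variable {m : ℕ} {M : Type*} [EMetricSpace M] [ChartedSpace (EuclideanSpace ℝ (Fin m)) M]
  [RiemannianBundle (fun x : M ↦ TangentSpace (𝓡 m) x)]

/-- The Riemannian metric in the coordinates of the chart at `x₀`: if `φ` is that chart, this is
`⟨dφ⁻¹ u, dφ⁻¹ v⟩` at the point `φ⁻¹ y`. -/
def metricInChart (x₀ : M) (y u v : EuclideanSpace ℝ (Fin m)) : ℝ :=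
  inner ℝ (mfderiv (𝓡 m) (𝓡 m) (extChartAt (𝓡 m) x₀).symm y u)
    (mfderiv (𝓡 m) (𝓡 m) (extChartAt (𝓡 m) x₀).symm y v)

/-- The Christoffel symbol of the first kind of the Levi-Civita connection in the chart at `x₀`,
contracted with `u`, `v`, `w`:
`½ (∂_u ⟨v, w⟩ + ∂_v ⟨u, w⟩ - ∂_w ⟨u, v⟩) = ⟨Γ(u, v), w⟩`. -/
def christoffelInChart (x₀ : M) (y u v w : EuclideanSpace ℝ (Fin m)) : ℝ :=
  (fderiv ℝ (fun z ↦ metricInChart x₀ z v w) y u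
    + fderiv ℝ (fun z ↦ metricInChart x₀ z u w) y v
    - fderiv ℝ (fun z ↦ metricInChart x₀ z u v) y w) / 2

/-- A curve in `M`, defined on `[0,1]`, read in the chart at `x₀`. -/
def curveInChart (x₀ : M) (γ : ℝ → M) (s : ℝ) : EuclideanSpace ℝ (Fin m) :=
  extChartAt (𝓡 m) x₀ (γ s)

/-- The components, in the chart at `x₀`, of a vector field along a curve. -/
def fieldInChart (x₀ : M) (V : ℝ → TangentBundle (𝓡 m) M) (s : ℝ) :
    EuclideanSpace ℝ (Fin m) :=
  mfderiv (𝓡 m) (𝓡 m) (extChartAt (𝓡 m) x₀) (V s).proj (V s).snd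

/-- The covariant derivative (for the Levi-Civita connection) at time `t ∈ [0,1]` of the vector
field `V` along its base curve `γ` exists and vanishes: in coordinates, with `c` the curve and `v`
the components of the field, `v' + Γ(c', v) = 0`, tested against every vector `w`. The equation is
invariant under changes of coordinates, so that the chart around `γ t` does not matter. -/
def CovDerivVanishesAt (V : ℝ → TangentBundle (𝓡 m) M) (t : ℝ) : Prop :=
  ∃ x₀ : M, (V t).proj ∈ (chartAt (EuclideanSpace ℝ (Fin m)) x₀).source ∧
    DifferentiableWithinAt ℝ (curveInChart (m := m) x₀ fun s ↦ (V s).proj) (Icc 0 1) t ∧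
    DifferentiableWithinAt ℝ (fieldInChart x₀ V) (Icc 0 1) t ∧
    ∀ w : EuclideanSpace ℝ (Fin m),
      metricInChart x₀ (curveInChart (m := m) x₀ (fun s ↦ (V s).proj) t)
          (derivWithin (fieldInChart x₀ V) (Icc 0 1) t) w
        + christoffelInChart x₀ (curveInChart (m := m) x₀ (fun s ↦ (V s).proj) t)
            (derivWithin (curveInChart (m := m) x₀ fun s ↦ (V s).proj) (Icc 0 1) t)
            (fieldInChart x₀ V t) w = 0

/-- `V` is a parallel vector field along the smooth curve `γ : [0,1] → M`. -/
def IsParallelAlong (γ : ℝ → M) (V : ℝ → TangentBundle (𝓡 m) M) : Prop :=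
  ContMDiffOn 𝓘(ℝ, ℝ) (𝓡 m) ∞ γ (Icc 0 1) ∧ (∀ t, (V t).proj = γ t) ∧
    ∀ t ∈ Icc (0 : ℝ) 1, CovDerivVanishesAt V t

/-- The velocity field of a curve `γ : [0,1] → M`. -/
def velocity (γ : ℝ → M) (t : ℝ) : TangentBundle (𝓡 m) M :=
  ⟨γ t, mfderivWithin 𝓘(ℝ, ℝ) (𝓡 m) γ (Icc 0 1) t (1 : ℝ)⟩

variable (m) in
/-- `γ : [0,1] → M` is a geodesic segment: it is smooth and its velocity is parallel along it. -/
def IsGeodesic (γ : ℝ → M) : Prop :=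
  IsParallelAlong (m := m) γ (velocity γ)

variable (m) in
/-- `γ : [0,1] → M` is a minimal geodesic segment from `x` to `y`. -/
def IsMinimalGeodesic (γ : ℝ → M) (x y : M) : Prop :=
  IsGeodesic m γ ∧ γ 0 = x ∧ γ 1 = y ∧ Manifold.pathELength (𝓡 m) γ 0 1 = edist x y

variable (m) in
/-- `γ` is, as a curve on `[0,1]`, the unique minimal geodesic segment from `x` to `y`. -/
def IsUniqueMinimalGeodesic (γ : ℝ → M) (x y : M) : Prop :=
  IsMinimalGeodesic m γ x y ∧ ∀ γ', IsMinimalGeodesic m γ' x y → EqOn γ' γ (Icc 0 1)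

/-- `τ : T_x M → T_y M` is the parallel translation from `x` to `y`; it is only defined if `x` and
`y` are joined by a unique minimal geodesic segment, and is then taken along that segment. -/
def IsParallelTranslation (x y : M)
    (τ : TangentSpace (𝓡 m) x →L[ℝ] TangentSpace (𝓡 m) y) : Prop :=
  ∃ γ : ℝ → M, IsUniqueMinimalGeodesic m γ x y ∧
    ∀ v : TangentSpace (𝓡 m) x, ∃ V : ℝ → TangentBundle (𝓡 m) M,
      IsParallelAlong γ V ∧ V 0 = ⟨x, v⟩ ∧ V 1 = ⟨y, τ v⟩

variable (m) in
/-- Strong convexity of a set `B`: any two points of its closure are joined by a unique minimal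
geodesic segment, and (if the two points differ) the interior of this segment lies in `B`. -/
def IsStronglyConvex (B : Set M) : Prop :=
  ∀ x ∈ closure B, ∀ y ∈ closure B, ∃ γ : ℝ → M, IsUniqueMinimalGeodesic m γ x y ∧
    (x ≠ y → ∀ t ∈ Ioo (0 : ℝ) 1, γ t ∈ B)

open Classical in
/-- The exponential map at `x`: `exp_x v = γ 1` for the geodesic `γ` with `γ 0 = x`, `γ' 0 = v`.
(On a complete manifold the geodesic always exists; the other value is never used.) -/
def expMap (x : M) (v : TangentSpace (𝓡 m) x) : M :=
  if h : ∃ γ : ℝ → M, IsGeodesic m γ ∧ velocity γ 0 = (⟨x, v⟩ : TangentBundle (𝓡 m) M) then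
    h.choose 1
  else x

/-- `exp_x`, restricted to the open set `s` of `T_x M`, is a diffeomorphism of `s` onto the open
set `t` of `M`. -/
def ExpIsDiffeo (x : M) (s : Set (TangentSpace (𝓡 m) x)) (t : Set M) : Prop :=
  IsOpen s ∧ IsOpen t ∧ BijOn (expMap x) s t ∧
    ContMDiffOn 𝓘(ℝ, TangentSpace (𝓡 m) x) (𝓡 m) ∞ (expMap x) s ∧
    ∃ g : M → TangentSpace (𝓡 m) x,
      ContMDiffOn (𝓡 m) 𝓘(ℝ, TangentSpace (𝓡 m) x) ∞ g t ∧ LeftInvOn g (expMap x) s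

variable (m) in
/-- The open ball of radius `r` about `x` is strongly convex, and `exp_x` is a diffeomorphism of the
ball of radius `r` about the origin of `T_x M` onto it. -/
def IsConvexRadius (x : M) (r : ℝ) : Prop :=
  0 < r ∧ IsStronglyConvex m (Metric.eball x (ENNReal.ofReal r)) ∧
    ExpIsDiffeo x (Metric.ball (0 : TangentSpace (𝓡 m) x) r) (Metric.eball x (ENNReal.ofReal r))

variable (m) in
/-- The injectivity radius at `x`: the supremum of all `r > 0` such that `exp_x` restricted to the
ball of radius `r` is a diffeomorphism onto its image. -/
def injRadiusAt (x : M) : ℝ≥0∞ :=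
  ⨆ (r : ℝ) (_ : 0 < r ∧ ExpIsDiffeo x (Metric.ball (0 : TangentSpace (𝓡 m) x) r)
    (expMap x '' Metric.ball (0 : TangentSpace (𝓡 m) x) r)), ENNReal.ofReal r

variable (m M) in
/-- The injectivity radius of `M`. -/
def injRadius : ℝ≥0∞ := ⨅ x : M, injRadiusAt m x

end Curves

section Clarke

variable {m : ℕ} {M : Type*} [EMetricSpace M] [ChartedSpace (EuclideanSpace ℝ (Fin m)) M]

variable (m) in
/-- The differential of a real function, `T_y ℝ` being identified with `ℝ`. -/
def differential (f : M → ℝ) (x : M) : TangentSpace (𝓡 m) x →L[ℝ] ℝ :=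
  (NormedSpace.fromTangentSpace (𝕜 := ℝ) (f x)).toContinuousLinearMap.comp
    (mfderiv (𝓡 m) 𝓘(ℝ, ℝ) f x)

variable (m) in
/-- A subset of the manifold of Lebesgue measure zero, i.e. of measure zero in every chart. -/
def IsLebesgueNull (A : Set M) : Prop :=
  ∀ x₀ : M, volume (extChartAt (𝓡 m) x₀ '' (A ∩ (extChartAt (𝓡 m) x₀).source)) = 0

variable [RiemannianBundle (fun x : M ↦ TangentSpace (𝓡 m) x)]

variable (m) in
/-- The mixture `K_F(p)` of the differential of `F : M → ℝ` at `p`, formed with the ball of radius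
`r` about `p` and the exceptional set `A`: all limits of `dF_{x_i} ∘ τ_i`, where `x_i → p` in the
ball minus `A` and `τ_i : T_p M → T_{x_i} M` is the parallel translation. (The parallel translation
`T_{F(x_i)} ℝ → T_{F(p)} ℝ` is the identity of `ℝ`.) -/
def mixture (F : M → ℝ) (p : M) (r : ℝ) (A : Set M) :
    Set (TangentSpace (𝓡 m) p →L[ℝ] ℝ) :=
  {G | ∃ (x : ℕ → M) (τ : ∀ i, TangentSpace (𝓡 m) p →L[ℝ] TangentSpace (𝓡 m) (x i)),
    (∀ i, x i ∈ Metric.eball p (ENNReal.ofReal r) \ A) ∧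
    (∀ i, IsParallelTranslation p (x i) (τ i)) ∧
    Tendsto x atTop (𝓝 p) ∧
    Tendsto (fun i ↦ (differential m F (x i)).comp (τ i)) atTop (𝓝 G)}

variable (m) in
/-- The generalized differential `∂F(p)`, the convex hull of the mixture. -/
def generalizedDifferential (F : M → ℝ) (p : M) (r : ℝ) (A : Set M) :
    Set (TangentSpace (𝓡 m) p →L[ℝ] ℝ) :=
  convexHull ℝ (mixture m F p r A)

variable (m) in
/-- `p` is nonsingular for `F : M → ℝ` in the sense of Clarke: every element of the generalized
differential at `p` has maximal rank `min {m, 1}`. The generalized differential is formed with a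
choice of a strongly convex ball about `p` and of a Lebesgue null set outside of which `F` is
differentiable on this ball; it does not depend on these choices. -/
def IsClarkeNonsingular (F : M → ℝ) (p : M) : Prop :=
  ∃ (r : ℝ) (A : Set M), IsConvexRadius m p r ∧ IsLebesgueNull m A ∧
    (∀ x ∈ Metric.eball p (ENNReal.ofReal r) \ A, MDifferentiableAt (𝓡 m) 𝓘(ℝ, ℝ) F x) ∧
    ∀ g ∈ generalizedDifferential m F p r A,
      Module.finrank ℝ (LinearMap.range g.toLinearMap) = min m 1

end Clarke

section Approximation

variable {m : ℕ} {M : Type*} [EMetricSpace M] [ChartedSpace (EuclideanSpace ℝ (Fin m)) M]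

instance (x : M) : FiniteDimensional ℝ (TangentSpace (𝓡 m) x) :=
  inferInstanceAs (FiniteDimensional ℝ (EuclideanSpace ℝ (Fin m)))

instance (x : M) : MeasurableSpace (TangentSpace (𝓡 m) x) := borel _

instance (x : M) : BorelSpace (TangentSpace (𝓡 m) x) := ⟨rfl⟩

variable [RiemannianBundle (fun x : M ↦ TangentSpace (𝓡 m) x)]

variable (m) in
/-- The gradient of a function `f : M → ℝ`: the vector with `⟨grad f, u⟩ = df(u)` for all `u`. -/
def riemGrad (f : M → ℝ) (x : M) : TangentSpace (𝓡 m) x :=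
  haveI : CompleteSpace (TangentSpace (𝓡 m) x) := FiniteDimensional.complete ℝ _
  (InnerProductSpace.toDual ℝ (TangentSpace (𝓡 m) x)).symm (differential m f x)

variable (m) in
/-- `x` is a critical point of `f`: the differential of `f` vanishes at `x`. -/
def IsCriticalPt (f : M → ℝ) (x : M) : Prop := differential m f x = 0

/-- The unnormalized bump function `e^{-1/(1-‖y‖²)}` on the unit ball of `T_x M`. -/
def bump {x : M} (y : TangentSpace (𝓡 m) x) : ℝ :=
  if ‖y‖ < 1 then Real.exp (-1 / (1 - ‖y‖ ^ 2)) else 0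

/-- The mollifier `ρ_ε(y) = ρ(y / ε) / ε^m` on `T_x M`, where `ρ` is the bump function normalized to
have integral `1` with respect to the Lebesgue measure of the Euclidean space `T_x M`. -/
def mollifier (x : M) (ε : ℝ) (y : TangentSpace (𝓡 m) x) : ℝ :=
  (∫ z : TangentSpace (𝓡 m) x, bump z)⁻¹ * bump (ε⁻¹ • y) / ε ^ m

variable (m) in
/-- The inverse of `exp_x` on the ball of radius `r`. -/
def expInv (x : M) (r : ℝ) : M → TangentSpace (𝓡 m) x :=
  Function.invFunOn (expMap x) (Metric.ball 0 r)

variable (m) in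
/-- The local smooth approximation of `F` on the ball of radius `r` about `x`: the convolution of
`F ∘ exp_x` with the mollifier, in normal coordinates. -/
def localApprox (F : M → ℝ) (x : M) (r ε : ℝ) (q : M) : ℝ :=
  ∫ y : TangentSpace (𝓡 m) x, mollifier x ε y * F (expMap x (expInv m x r q - y))

variable (m M) in
/-- The choices that enter the global smooth approximation: a finite cover of `M` by strongly convex
balls whose radii are less than half of the injectivity radius, and a smooth partition of unity
subordinate to this cover. -/
structure ApproxData where
  /-- the number of balls -/
  k : ℕ
  /-- the centers of the balls -/
  center : Fin k → M
  /-- the radii of the balls -/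
  radius : Fin k → ℝ
  convexRadius : ∀ i, IsConvexRadius m (center i) (radius i)
  radius_lt : ∀ i, ENNReal.ofReal (radius i) < injRadius m M / 2
  cover : ⋃ i, Metric.eball (center i) (ENNReal.ofReal (radius i)) = univ
  /-- the partition of unity -/
  ψ : SmoothPartitionOfUnity (Fin k) (𝓡 m) M univ
  subordinate : ψ.IsSubordinate fun i ↦ Metric.eball (center i) (ENNReal.ofReal (radius i))

/-- The global smooth approximation `F̃_ε` of `F`. -/
def ApproxData.globalApprox (D : ApproxData m M) (F : M → ℝ) (ε : ℝ) (q : M) : ℝ :=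
  ∑ i, D.ψ i q * localApprox m F (D.center i) (D.radius i) ε q

end Approximation

end LipApprox

end

noncomputable section

set_option maxSynthPendingDepth 3
set_option linter.unusedSectionVars false

namespace LipApprox

/-! ### Convexity, almost everywhere derivatives and linear differential equations -/

section Euclidean

/-! Work in the chart at `p`, where `F` becomes a Lipschitz function `f` on a Euclidean ball. Since
`m ≥ 1`, nonsingularity says that `0` is not in `∂F(p)`. Parallel translation from `p` to a nearby
`x` differs from the identity of the chart by `O(d(p,x))` (`exists_parallelTranslation_near`, a
Picard-Lindelöf estimate along the minimal geodesic), so every limit of `df` at the base point,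
taken off the exceptional null set, gives an element of `K_F(p)` (`comp_chartDiff_mem_mixture`).
These limits form a compact set whose convex hull omits `0`. Hahn-Banach then yields one vector `v`
and `c > 0` with `df(v) ≥ c` almost everywhere near the base point.

Integrating, `f (y + s v) - f y ≥ c s` for all nearby points
(`IsClarkeNonsingular.exists_increment`). This inequality no longer mentions derivatives. It
therefore survives a change to the normal coordinates of any ball of the cover, with `c / 2` in
place of `c` (`exists_increment_comp`), and also averaging against a mollifier. So each local
approximation `F_i` with `p_i` relevant at the given point has derivative at least `c / 2` along `v`
and is uniformly close to `F` (`eventually_mollification`).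

In the derivative of `∑ ψ_i F_i` along `v`, the terms `ψ_i dF_i(v)` average to at least `c / 2`.
Because `∑ dψ_i = 0`, the remaining terms equal `∑ (F_i - F) dψ_i(v)`, which is small for small `ε`
(`eventually_pos_fderiv_sum`). The neighbourhood where `v` works comes from `F` and `p` alone, which
fixes `λ(p)` before the cover is chosen; compactness of a closed ball makes the bound on `ε`
uniform. -/

/-- In a finite-dimensional space the convex hull of a compact set is compact. -/
theorem isCompact_convexHull_of_isCompact {E : Type*} [NormedAddCommGroup E] [NormedSpace ℝ E]
    [FiniteDimensional ℝ E] {K : Set E} (hK : IsCompact K) : IsCompact (convexHull ℝ K) := by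
  rcases K.eq_empty_or_nonempty with rfl | ⟨k₀, hk₀⟩
  · simp
  -- Carathéodory: `finrank + 1` points suffice, so the hull is a continuous image of the compact
  -- product of a simplex with a power of `K`.
  set d := Module.finrank ℝ E + 1 with hd
  have hc : IsCompact ((fun x : (Fin d → ℝ) × (Fin d → E) ↦ ∑ i, x.1 i • x.2 i) ''
      (stdSimplex ℝ (Fin d) ×ˢ univ.pi fun _ ↦ K)) :=
    ((isCompact_stdSimplex ℝ (Fin d)).prod (isCompact_univ_pi fun _ ↦ hK)).image (by fun_prop)
  convert hc using 1
  apply Subset.antisymm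
  · intro x hx
    obtain ⟨ι, hι, z, w, hz, hz', hw, hw1, hx⟩ := eq_pos_convex_span_of_mem_convexHull hx
    have hcard : Fintype.card ι ≤ Fintype.card (Fin d) := by
      rw [Fintype.card_fin, hd]
      exact hz'.card_le_finrank_succ.trans
        (Nat.add_le_add_right (Submodule.finrank_le _) 1)
    obtain ⟨e⟩ := Function.Embedding.nonempty_of_card_le hcard
    have hnot : ∀ i ∉ range e, ¬ ∃ a, e a = i := fun i hi ⟨a, ha⟩ ↦ hi ⟨a, ha⟩
    -- Unused slots receive weight `0` and the arbitrary point `k₀` of `K`.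
    refine ⟨(Function.extend e w 0, Function.extend e z fun _ ↦ k₀), ⟨⟨?_, ?_⟩, ?_⟩, ?_⟩
    · intro i
      by_cases hi : i ∈ range e
      · obtain ⟨a, rfl⟩ := hi
        simpa [e.injective.extend_apply] using (hw a).le
      · simp [Function.extend_apply' _ _ _ (hnot i hi)]
    · rw [← hw1]
      symm
      refine Fintype.sum_of_injective e e.injective _ _ (fun i hi ↦ ?_) fun i ↦ ?_
      · simp [Function.extend_apply' _ _ _ (hnot i hi)]
      · simp [e.injective.extend_apply]
    · intro i _
      by_cases hi : i ∈ range e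
      · obtain ⟨a, rfl⟩ := hi
        simpa [e.injective.extend_apply] using hz ⟨a, rfl⟩
      · simpa [Function.extend_apply' _ _ _ (hnot i hi)] using hk₀
    · rw [← hx]
      symm
      refine Fintype.sum_of_injective e e.injective _ _ (fun i hi ↦ ?_) fun i ↦ ?_
      · simp [Function.extend_apply' _ _ _ (hnot i hi)]
      · simp [e.injective.extend_apply]
  · rintro _ ⟨⟨w, z⟩, ⟨⟨hw, hw1⟩, hz⟩, rfl⟩
    exact (convex_convexHull ℝ K).sum_mem (fun i _ ↦ hw i) hw1
      fun i _ ↦ subset_convexHull ℝ K (hz i (mem_univ i))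

/-- A compact set of covectors whose convex hull omits `0` is uniformly positive on some vector. -/
theorem exists_forall_lt_apply_of_zero_notMem_convexHull {E : Type*} [NormedAddCommGroup E]
    [InnerProductSpace ℝ E] [FiniteDimensional ℝ E] {K : Set (E →L[ℝ] ℝ)} (hK : IsCompact K)
    (h0 : (0 : E →L[ℝ] ℝ) ∉ convexHull ℝ K) : ∃ (v : E) (c : ℝ), 0 < c ∧ ∀ g ∈ K, c < g v := by
  obtain ⟨l, c, h0c, hl⟩ := geometric_hahn_banach_point_closed (convex_convexHull ℝ K)
    (isCompact_convexHull_of_isCompact hK).isClosed h0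
  have : CompleteSpace E := FiniteDimensional.complete ℝ E
  -- The separating functional `l` lives on the dual space; by Riesz it is evaluation at this `v`.
  set v : E := (InnerProductSpace.toDual ℝ E).symm (l.comp (innerSL ℝ)) with hv
  refine ⟨v, c, by simpa using h0c, fun g hg ↦ ?_⟩
  have h1 : g v = l g := by
    have h2 : inner ℝ v ((InnerProductSpace.toDual ℝ E).symm g) = l g := by
      rw [hv, InnerProductSpace.toDual_symm_apply]
      rw [ContinuousLinearMap.comp_apply]
      congr 1
      ext x
      rw [innerSL_apply_apply, InnerProductSpace.toDual_symm_apply]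
    rw [← h2, real_inner_comm, InnerProductSpace.toDual_symm_apply]
  rw [h1]
  exact hl g (subset_convexHull ℝ K hg)

/-- A Lipschitz function whose derivative in the direction `v` is almost everywhere at least `c`
increases at least at the rate `c` in that direction. -/
theorem mul_le_sub_of_ae_le_fderiv {E : Type*} [NormedAddCommGroup E] [NormedSpace ℝ E]
    [FiniteDimensional ℝ E] [MeasurableSpace E] [BorelSpace E] (μ : Measure E)
    [μ.IsAddHaarMeasure] {f : E → ℝ} {y₀ : E} {R : ℝ} {L : ℝ≥0}
    (hf : LipschitzOnWith L f (Metric.ball y₀ R)) {v : E} {c : ℝ}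
    (h : ∀ᵐ y ∂μ, y ∈ Metric.ball y₀ R → DifferentiableAt ℝ f y ∧ c ≤ fderiv ℝ f y v)
    {y : E} {s : ℝ} (hs : 0 ≤ s) (hy : y ∈ Metric.ball y₀ R)
    (hys : y + s • v ∈ Metric.ball y₀ R) : c * s ≤ f (y + s • v) - f y := by
  -- A globally Lipschitz extension makes integrals over translated balls harmless; on the open ball
  -- its derivatives are those of `f`.
  obtain ⟨g, hg, hfg⟩ := hf.extend_real
  have hgd : ∀ᵐ y ∂μ, y ∈ Metric.ball y₀ R → DifferentiableAt ℝ g y ∧ c ≤ fderiv ℝ g y v := by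
    filter_upwards [h] with x hx hxb
    have he : f =ᶠ[𝓝 x] g := Filter.eventually_of_mem (Metric.isOpen_ball.mem_nhds hxb) hfg
    rw [← he.differentiableAt_iff, ← he.fderiv_eq]
    exact hx hxb
  rw [hfg hy, hfg hys]
  -- The hypothesis says nothing about one given segment, which may lie in the null set. By
  -- continuity a failure at `y` persists on a small ball `B`, with a constant `c' < c * s`. The
  -- integral of `g (x + t • v)` over `x ∈ B` has `t`-derivative at least `c * μ B`, which
  -- contradicts this.
  by_contra! hlt
  obtain ⟨c', hc'1, hc'2⟩ := exists_between hlt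
  have hcont : Continuous fun x ↦ g (x + s • v) - g x := by
    have := hg.continuous
    fun_prop
  have hU : {x | g (x + s • v) - g x < c'} ∩ (Metric.ball y₀ R ∩
      (fun x ↦ x + s • v) ⁻¹' Metric.ball y₀ R) ∈ 𝓝 y := by
    refine ((isOpen_lt hcont continuous_const).inter (Metric.isOpen_ball.inter
      (Metric.isOpen_ball.preimage (by fun_prop)))).mem_nhds ⟨hc'1, hy, hys⟩
  obtain ⟨δ, hδ, hδU⟩ := Metric.mem_nhds_iff.1 hU
  set B := Metric.ball y δ with hB
  have : IsFiniteMeasure (μ.restrict B) := ⟨by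
    rw [Measure.restrict_apply_univ]; exact measure_ball_lt_top⟩
  have hseg : ∀ x ∈ B, ∀ t ∈ Icc 0 s, x + t • v ∈ Metric.ball y₀ R := by
    intro x hx t ht
    rcases hs.eq_or_lt with rfl | hs'
    · obtain rfl : t = 0 := le_antisymm ht.2 ht.1
      simpa using (hδU hx).2.1
    · have := (convex_ball y₀ R).add_smul_mem (hδU hx).2.1 (hδU hx).2.2
        (t := t / s) ⟨by have := ht.1; positivity, by rw [div_le_one hs']; exact ht.2⟩
      rwa [smul_smul, div_mul_cancel₀ _ hs'.ne'] at this
  have hint : ∀ t : ℝ, Integrable (fun x ↦ g (x + t • v)) (μ.restrict B) := by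
    intro t
    have hc : Continuous fun x ↦ g (x + t • v) := by
      have := hg.continuous
      fun_prop
    exact (hc.locallyIntegrable.integrableOn_isCompact (isCompact_closedBall y δ)).mono_set
      Metric.ball_subset_closedBall
  have hder : ∀ t ∈ Icc 0 s, Integrable (fun x ↦ fderiv ℝ g (x + t • v) v) (μ.restrict B) ∧
      HasDerivAt (fun t : ℝ ↦ ∫ x, g (x + t • v) ∂μ.restrict B)
        (∫ x, fderiv ℝ g (x + t • v) v ∂μ.restrict B) t ∧
      ∀ᵐ x ∂μ.restrict B, c ≤ fderiv ℝ g (x + t • v) v := by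
    intro t ht
    have hae : ∀ᵐ x ∂μ.restrict B, DifferentiableAt ℝ g (x + t • v) ∧
        c ≤ fderiv ℝ g (x + t • v) v := by
      rw [ae_restrict_iff' measurableSet_ball]
      -- For each fixed `t` the translated exceptional set is null; no null set common to all `t` is
      -- needed.
      filter_upwards [(measurePreserving_add_right μ (t • v)).quasiMeasurePreserving.ae hgd]
        with x hx hxB using hx (hseg x hxB t ht)
    have := hasDerivAt_integral_of_dominated_loc_of_lip (μ := μ.restrict B)
      (F := fun (t : ℝ) x ↦ g (x + t • v)) (x₀ := t) (s := univ)
      (F' := fun x ↦ fderiv ℝ g (x + t • v) v) (bound := fun _ ↦ L * ‖v‖) univ_mem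
      (Eventually.of_forall fun t ↦ (hint t).aestronglyMeasurable) (hint t)
      ((measurable_fderiv_apply_const ℝ g v).comp
        (measurable_id.add_const (t • v))).aestronglyMeasurable
      (Eventually.of_forall fun x ↦ by
        refine LipschitzWith.lipschitzOnWith ?_
        refine LipschitzWith.of_dist_le_mul fun a b ↦ ?_
        refine (hg.dist_le_mul _ _).trans ?_
        rw [dist_add_left, dist_eq_norm, ← sub_smul, norm_smul, Real.coe_nnabs,
          abs_of_nonneg (by positivity), dist_eq_norm]
        exact le_of_eq (by ring))
      (integrable_const _)
      (by
        filter_upwards [hae] with x hx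
        have h2 : HasDerivAt (fun t : ℝ ↦ x + t • v) v t := by
          simpa using ((hasDerivAt_id t).smul_const v).const_add x
        exact hx.1.hasFDerivAt.comp_hasDerivAt t h2)
    exact ⟨this.1, this.2, hae.mono fun x hx ↦ hx.2⟩
  have hV : 0 < μ.real B := by
    rw [Measure.real, ENNReal.toReal_pos_iff]
    exact ⟨Metric.measure_ball_pos μ y hδ, measure_ball_lt_top⟩
  have hmv := (convex_Icc 0 s).mul_sub_le_image_sub_of_le_deriv
    (f := fun t : ℝ ↦ ∫ x, g (x + t • v) ∂μ.restrict B) (C := c * μ.real B)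
    (fun t ht ↦ (hder t ht).2.1.continuousAt.continuousWithinAt)
    (fun t ht ↦ (hder t (interior_subset ht)).2.1.differentiableAt.differentiableWithinAt)
    (fun t ht ↦ by
      obtain ⟨h1, h2, h3⟩ := hder t (interior_subset ht)
      rw [h2.deriv]
      calc c * μ.real B = ∫ _, c ∂μ.restrict B := by simp [mul_comm]
        _ ≤ _ := integral_mono_ae (integrable_const _) h1 h3) 0 ⟨le_rfl, hs⟩ s ⟨hs, le_rfl⟩ hs
  have hup : (∫ x, g (x + s • v) ∂μ.restrict B) - ∫ x, g (x + (0 : ℝ) • v) ∂μ.restrict B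
      ≤ c' * μ.real B := by
    rw [← integral_sub (hint s) (hint 0)]
    calc _ ≤ ∫ _, c' ∂μ.restrict B := by
          refine setIntegral_mono_on ((hint s).sub (hint 0)) (integrable_const _)
            measurableSet_ball fun x hx ↦ ?_
          have := (hδU hx).1
          simp only [mem_ofPred_eq] at this
          simpa using this.le
      _ = _ := by simp [mul_comm]
  nlinarith

/-- A linear differential equation with small coefficients has a fundamental solution on `[0,1]`
that is close to the identity. -/
theorem exists_fundamentalSolution {B : Type*} [NormedRing B] [NormedAlgebra ℝ B] [CompleteSpace B]
    (h1 : ‖(1 : B)‖ ≤ 1) {A : ℝ → B} (hA : ContinuousOn A (Icc 0 1)) {k : ℝ} (hk : k ≤ 1 / 2)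
    (hAk : ∀ t ∈ Icc (0 : ℝ) 1, ‖A t‖ ≤ k) :
    ∃ T : ℝ → B, T 0 = 1 ∧ (∀ t ∈ Icc (0 : ℝ) 1, HasDerivWithinAt T (A t * T t) (Icc 0 1) t) ∧
      ‖T 1 - 1‖ ≤ 2 * k := by
  have hk0 : 0 ≤ k := (norm_nonneg _).trans (hAk 0 (by simp))
  -- On the ball of radius `1` about `1` norms are at most `2`, so `k ≤ 1 / 2` bounds the field by
  -- `1` and the solution cannot leave the ball within unit time.
  have hpl : IsPicardLindelof (fun t x ↦ A t * x) (⟨0, by simp⟩ : Icc (0 : ℝ) 1) (1 : B)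
      1 0 1 1 := by
    refine ⟨fun t ht ↦ ?_, fun x _ ↦ hA.mul continuousOn_const, fun t ht x hx ↦ ?_, by simp⟩
    · refine LipschitzOnWith.of_dist_le_mul fun x _ y _ ↦ ?_
      rw [dist_eq_norm, ← mul_sub, dist_eq_norm]
      refine (norm_mul_le _ _).trans ?_
      have := hAk t ht
      push_cast
      gcongr
      linarith
    · have hx2 : ‖x‖ ≤ 2 := by
        rw [mem_closedBall_iff_norm] at hx
        push_cast at hx
        linarith [norm_le_norm_sub_add x 1]
      refine (norm_mul_le _ _).trans ?_
      have := hAk t ht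
      push_cast
      nlinarith [norm_nonneg x, norm_nonneg (A t)]
  obtain ⟨T, hT0, hT⟩ := hpl.exists_eq_forall_mem_Icc_hasDerivWithinAt₀
  refine ⟨T, hT0, hT, ?_⟩
  simp only at hT0
  -- With `S` the maximum of `‖T‖`, the equation gives `‖T t - 1‖ ≤ k * S`, hence `S ≤ 1 + S / 2`,
  -- so `S ≤ 2` and the deviation from `1` is at most `2 * k`.
  obtain ⟨t₁, ht₁, hmax⟩ := isCompact_Icc.exists_isMaxOn (nonempty_Icc.2 zero_le_one)
    (HasDerivWithinAt.continuousOn hT).norm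
  have hbd : ∀ t ∈ Icc (0 : ℝ) 1, ‖A t * T t‖ ≤ k * ‖T t₁‖ := fun t ht ↦
    (norm_mul_le _ _).trans (mul_le_mul (hAk t ht) (hmax ht) (norm_nonneg _) hk0)
  have hdiff : ∀ t ∈ Icc (0 : ℝ) 1, ‖T t - 1‖ ≤ k * ‖T t₁‖ := by
    intro t ht
    have := norm_image_sub_le_of_norm_deriv_le_segment' hT (fun t ht ↦ hbd t ⟨ht.1, ht.2.le⟩) t ht
    rw [hT0] at this
    refine this.trans ?_
    have h2 := ht.2
    exact mul_le_of_le_one_right (by positivity) (by linarith)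
  have hS : ‖T t₁‖ ≤ 2 := by
    have := hdiff t₁ ht₁
    have := norm_le_norm_sub_add (T t₁) 1
    nlinarith [norm_nonneg (T t₁)]
  refine (hdiff 1 (by simp)).trans ?_
  nlinarith

/-! ### Convolution with a compactly supported kernel -/

section Mollification

variable {E : Type*} [NormedAddCommGroup E] [NormedSpace ℝ E] [FiniteDimensional ℝ E]
  [MeasurableSpace E] [BorelSpace E] {μ : Measure E} [μ.IsAddHaarMeasure]
  {ρ f : E → ℝ} {ε : ℝ} {z z₀ : E} {R : ℝ}

theorem integrable_mul_comp_sub (hρ : Continuous ρ) (hρ0 : ∀ y, ε ≤ ‖y‖ → ρ y = 0)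
    (hf : ContinuousOn f (Metric.ball z₀ R)) (hz : dist z z₀ + ε < R) :
    Integrable (fun y ↦ ρ y * f (z - y)) μ := by
  have hsub : Function.support (fun y ↦ ρ y * f (z - y)) ⊆ Metric.closedBall 0 ε := by
    intro y hy
    by_contra hy'
    rw [mem_closedBall_zero_iff, not_le] at hy'
    exact hy (by simp [hρ0 y hy'.le])
  rw [← integrableOn_iff_integrable_of_support_subset hsub]
  refine ContinuousOn.integrableOn_compact (isCompact_closedBall 0 ε)
    (hρ.continuousOn.mul (hf.comp (by fun_prop) fun y hy ↦ ?_))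
  rw [mem_closedBall_zero_iff] at hy
  rw [Metric.mem_ball, dist_eq_norm]
  rw [dist_eq_norm] at hz
  calc ‖z - y - z₀‖ = ‖(z - z₀) - y‖ := by congr 1; abel
    _ ≤ ‖z - z₀‖ + ‖y‖ := norm_sub_le _ _
    _ < R := by linarith

/-- Only values of `f` within `ε` of `z` enter, so near `z` the integral is the convolution with `f`
cut off to a closed ball, and the kernel supplies the smoothness. -/
theorem differentiableAt_integral_mul_comp_sub (hρ : ContDiff ℝ 1 ρ)
    (hρ0 : ∀ y, ε ≤ ‖y‖ → ρ y = 0) (hf : ContinuousOn f (Metric.ball z₀ R))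
    (hz : dist z z₀ + ε < R) :
    DifferentiableAt ℝ (fun z ↦ ∫ y, ρ y * f (z - y) ∂μ) z := by
  obtain ⟨R', hR'1, hR'2⟩ := exists_between hz
  have hcs : HasCompactSupport ρ := by
    refine HasCompactSupport.of_support_subset_isCompact (isCompact_closedBall 0 ε) fun y hy ↦ ?_
    by_contra hy'
    rw [mem_closedBall_zero_iff, not_le] at hy'
    exact hy (hρ0 y hy'.le)
  have hloc : LocallyIntegrable ((Metric.closedBall z₀ R').indicator f) μ := by
    refine Integrable.locallyIntegrable ?_
    rw [integrable_indicator_iff measurableSet_closedBall]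
    exact (hf.mono (Metric.closedBall_subset_ball hR'2)).integrableOn_compact
      (isCompact_closedBall _ _)
  have hconv := (hcs.contDiff_convolution_left (n := 1) (μ := μ) (ContinuousLinearMap.mul ℝ ℝ)
    (by exact_mod_cast hρ) hloc).differentiable (by simp) z
  refine hconv.congr_of_eventuallyEq ?_
  have hev : ∀ᶠ z' in 𝓝 z, dist z' z₀ + ε < R' :=
    (continuous_id.dist continuous_const |>.add continuous_const).continuousAt.eventually_lt
      continuousAt_const hR'1
  filter_upwards [hev] with z' hz'
  rw [convolution_def]
  refine integral_congr_ae (Eventually.of_forall fun y ↦ ?_)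
  by_cases hy : ε ≤ ‖y‖
  · simp [hρ0 y hy]
  · rw [not_le] at hy
    have : z' - y ∈ Metric.closedBall z₀ R' := by
      rw [mem_closedBall_iff_norm]
      rw [dist_eq_norm] at hz'
      calc ‖z' - y - z₀‖ = ‖(z' - z₀) - y‖ := by congr 1; abel
        _ ≤ ‖z' - z₀‖ + ‖y‖ := norm_sub_le _ _
        _ ≤ R' := by linarith
    simp [indicator_of_mem this]

theorem abs_integral_mul_comp_sub_sub_le (hρ : Continuous ρ) (hρ0 : ∀ y, ε ≤ ‖y‖ → ρ y = 0)
    (hpos : ∀ y, 0 ≤ ρ y) (hint : ∫ y, ρ y ∂μ = 1)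
    (hf : ContinuousOn f (Metric.ball z₀ R)) (hz : dist z z₀ + ε < R) {a η : ℝ}
    (hη : ∀ y, ‖y‖ < ε → |f (z - y) - a| ≤ η) :
    |(∫ y, ρ y * f (z - y) ∂μ) - a| ≤ η := by
  have hρi : Integrable ρ μ := by
    by_contra h
    rw [integral_undef h] at hint
    exact zero_ne_one hint
  have h1 : (∫ y, ρ y * f (z - y) ∂μ) - a = ∫ y, ρ y * (f (z - y) - a) ∂μ := by
    simp_rw [mul_sub]
    rw [integral_sub (integrable_mul_comp_sub hρ hρ0 hf hz) (hρi.mul_const a),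
      integral_mul_const, hint, one_mul]
  rw [h1]
  calc |∫ y, ρ y * (f (z - y) - a) ∂μ| ≤ ∫ y, ρ y * η ∂μ := by
        rw [← Real.norm_eq_abs]
        refine norm_integral_le_of_norm_le (hρi.mul_const η) (Eventually.of_forall fun y ↦ ?_)
        rw [norm_mul, Real.norm_of_nonneg (hpos y)]
        by_cases hy : ε ≤ ‖y‖
        · simp [hρ0 y hy]
        · exact mul_le_mul_of_nonneg_left (hη y (not_le.1 hy)) (hpos y)
    _ = η := by rw [integral_mul_const, hint, one_mul]

/-- The growth inequality holds for every translate `z - y` in the support of the kernel, so it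
passes to the average and then to the limit of right difference quotients. -/
theorem le_fderiv_integral_mul_comp_sub (hρ : ContDiff ℝ 1 ρ)
    (hρ0 : ∀ y, ε ≤ ‖y‖ → ρ y = 0) (hpos : ∀ y, 0 ≤ ρ y) (hint : ∫ y, ρ y ∂μ = 1)
    (hf : ContinuousOn f (Metric.ball z₀ R)) (hz : dist z z₀ + ε < R) {w : E} {c : ℝ}
    (hinc : ∀ᶠ s : ℝ in 𝓝[>] 0, ∀ y, ‖y‖ < ε → c * s ≤ f (z - y + s • w) - f (z - y)) :
    c ≤ fderiv ℝ (fun z ↦ ∫ y, ρ y * f (z - y) ∂μ) z w := by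
  set Φ : E → ℝ := fun z ↦ ∫ y, ρ y * f (z - y) ∂μ
  have hρi : Integrable ρ μ := by
    by_contra h
    rw [integral_undef h] at hint
    exact zero_ne_one hint
  have hd : HasDerivAt (fun s : ℝ ↦ Φ (z + s • w)) (fderiv ℝ Φ z w) 0 := by
    have h2 : HasDerivAt (fun s : ℝ ↦ z + s • w) w 0 := by
      simpa using ((hasDerivAt_id (0 : ℝ)).smul_const w).const_add z
    have h3 : HasFDerivAt Φ (fderiv ℝ Φ z) (z + (0 : ℝ) • w) := by
      simpa using (differentiableAt_integral_mul_comp_sub hρ hρ0 hf hz).hasFDerivAt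
    exact h3.comp_hasDerivAt 0 h2
  have hlim : Tendsto (fun s : ℝ ↦ s⁻¹ * (Φ (z + s • w) - Φ z)) (𝓝[>] 0)
      (𝓝 (fderiv ℝ Φ z w)) := by
    simpa using hd.tendsto_slope_zero_right
  refine ge_of_tendsto hlim ?_
  have hev : ∀ᶠ s : ℝ in 𝓝[>] 0, dist (z + s • w) z₀ + ε < R := by
    refine nhdsWithin_le_nhds ?_
    have : ContinuousAt (fun s : ℝ ↦ dist (z + s • w) z₀ + ε) 0 := by fun_prop
    exact this.eventually_lt continuousAt_const (by simpa using hz)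
  filter_upwards [hinc, hev, self_mem_nhdsWithin] with s hs hsz hs0
  rw [inv_mul_eq_div, le_div_iff₀ hs0, ← integral_sub
    (integrable_mul_comp_sub hρ.continuous hρ0 hf hsz)
    (integrable_mul_comp_sub hρ.continuous hρ0 hf hz)]
  calc c * s = ∫ y, ρ y * (c * s) ∂μ := by rw [integral_mul_const, hint, one_mul]
    _ ≤ _ := by
      refine integral_mono (hρi.mul_const _)
        ((integrable_mul_comp_sub hρ.continuous hρ0 hf hsz).sub
        (integrable_mul_comp_sub hρ.continuous hρ0 hf hz)) fun y ↦ ?_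
      by_cases hy : ε ≤ ‖y‖
      · simp [hρ0 y hy]
      · have := mul_le_mul_of_nonneg_left (hs y (not_le.1 hy)) (hpos y)
        simp only
        rw [← mul_sub]
        convert this using 4
        abel

end Mollification

end Euclidean

/-! ### The Christoffel symbols as a multilinear form -/

section ChristoffelForm



variable {E : Type*} [NormedAddCommGroup E] [NormedSpace ℝ E]

/-- The Christoffel symbol of the first kind of a metric with derivative `D`, contracted with
`u`. -/
def christoffelForm (D : E →L[ℝ] E →L[ℝ] E →L[ℝ] ℝ) (u : E) : E →L[ℝ] E →L[ℝ] ℝ :=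
  (1 / 2 : ℝ) • (D u + D.flip u - (D.flip u).flip)

theorem christoffelForm_apply (D : E →L[ℝ] E →L[ℝ] E →L[ℝ] ℝ) (u v w : E) :
    christoffelForm D u v w = (D u v w + D v u w - D w u v) / 2 := by
  simp [christoffelForm]
  ring

theorem norm_christoffelForm_le (D : E →L[ℝ] E →L[ℝ] E →L[ℝ] ℝ) (u : E) :
    ‖christoffelForm D u‖ ≤ 3 / 2 * ‖D‖ * ‖u‖ := by
  have h1 := D.le_opNorm u
  have h2 := D.flip.le_opNorm u
  rw [ContinuousLinearMap.opNorm_flip] at h2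
  rw [christoffelForm, norm_smul]
  have h3 := norm_sub_le (D u + D.flip u) (D.flip u).flip
  have h4 := norm_add_le (D u) (D.flip u)
  rw [ContinuousLinearMap.opNorm_flip] at h3
  norm_num
  linarith

theorem continuous_christoffelForm :
    Continuous fun x : (E →L[ℝ] E →L[ℝ] E →L[ℝ] ℝ) × E ↦ christoffelForm x.1 x.2 := by
  have h1 : Continuous fun x : (E →L[ℝ] E →L[ℝ] E →L[ℝ] ℝ) × E ↦ x.1.flip x.2 :=
    ((ContinuousLinearMap.flipₗᵢ ℝ E E (E →L[ℝ] ℝ)).continuous.comp continuous_fst).clm_apply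
      continuous_snd
  have h2 : Continuous fun x : (E →L[ℝ] E →L[ℝ] E →L[ℝ] ℝ) × E ↦ (x.1.flip x.2).flip :=
    (ContinuousLinearMap.flipₗᵢ ℝ E E ℝ).continuous.comp h1
  exact (((continuous_fst.clm_apply continuous_snd).add h1).sub h2).const_smul (1 / 2 : ℝ)

end ChristoffelForm

/-! ### The Riemannian metric in a chart -/

section Chart

variable {m : ℕ} {M : Type*} [EMetricSpace M] [ChartedSpace (EuclideanSpace ℝ (Fin m)) M]

/-- The differential at `q` of the chart at `x₀`. -/
def chartDiff (x₀ q : M) : TangentSpace (𝓡 m) q →L[ℝ] EuclideanSpace ℝ (Fin m) :=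
  mfderiv (𝓡 m) (𝓡 m) (extChartAt (𝓡 m) x₀) q

/-- The differential at `y` of the inverse of the chart at `x₀`. -/
def chartSymmDiff (x₀ : M) (y : EuclideanSpace ℝ (Fin m)) :
    EuclideanSpace ℝ (Fin m) →L[ℝ] TangentSpace (𝓡 m) ((extChartAt (𝓡 m) x₀).symm y) :=
  mfderiv (𝓡 m) (𝓡 m) (extChartAt (𝓡 m) x₀).symm y

variable [IsManifold (𝓡 m) ∞ M]

theorem mdifferentiableAt_extChartAt_symm {x₀ : M} {y : EuclideanSpace ℝ (Fin m)}
    (hy : y ∈ (extChartAt (𝓡 m) x₀).target) :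
    MDifferentiableAt (𝓡 m) (𝓡 m) (extChartAt (𝓡 m) x₀).symm y := by
  have := (contMDiffOn_extChartAt_symm (I := 𝓡 m) (n := ∞) x₀).mdifferentiableOn (by simp) y hy
  exact this.mdifferentiableAt ((isOpen_extChartAt_target x₀).mem_nhds hy)

theorem chartDiff_chartSymmDiff {x₀ : M} {y : EuclideanSpace ℝ (Fin m)}
    (hy : y ∈ (extChartAt (𝓡 m) x₀).target) (v : EuclideanSpace ℝ (Fin m)) :
    chartDiff x₀ ((extChartAt (𝓡 m) x₀).symm y) (chartSymmDiff x₀ y v) = v := by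
  have := mfderiv_extChartAt_comp_mfderivWithin_extChartAt_symm (I := 𝓡 m) hy
  rw [ModelWithCorners.range_eq_univ, mfderivWithin_univ] at this
  exact congr($this v)

theorem chartSymmDiff_chartDiff {x₀ : M} {y : EuclideanSpace ℝ (Fin m)}
    (hy : y ∈ (extChartAt (𝓡 m) x₀).target)
    (v : TangentSpace (𝓡 m) ((extChartAt (𝓡 m) x₀).symm y)) :
    chartSymmDiff x₀ y (chartDiff x₀ ((extChartAt (𝓡 m) x₀).symm y) v) = v := by
  have := mfderivWithin_extChartAt_symm_comp_mfderiv_extChartAt (I := 𝓡 m) hy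
  rw [ModelWithCorners.range_eq_univ, mfderivWithin_univ] at this
  exact congr($this v)

variable [RiemannianBundle (fun x : M ↦ TangentSpace (𝓡 m) x)]
    [IsContMDiffRiemannianBundle (𝓡 m) ∞ (EuclideanSpace ℝ (Fin m))
      (fun x : M ↦ TangentSpace (𝓡 m) x)]

/-- The tangent map of the inverse chart carries constant fields to smooth fields, and the metric is
smooth on smooth fields. -/
theorem contDiffOn_metricInChart (x₀ : M) (v w : EuclideanSpace ℝ (Fin m)) :
    ContDiffOn ℝ ∞ (fun y ↦ metricInChart x₀ y v w) (extChartAt (𝓡 m) x₀).target := by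
  have key : ∀ v : EuclideanSpace ℝ (Fin m), ContMDiffOn (𝓡 m) (𝓡 m).tangent ∞
      (fun y ↦ (⟨(extChartAt (𝓡 m) x₀).symm y, chartSymmDiff x₀ y v⟩ : TangentBundle (𝓡 m) M))
      (extChartAt (𝓡 m) x₀).target := by
    intro v
    have h1 := (contMDiffOn_extChartAt_symm (I := 𝓡 m) (n := ∞) x₀).contMDiffOn_tangentMapWithin
      (m := ∞) (by simp) (isOpen_extChartAt_target x₀).uniqueMDiffOn
    have h2 : ContMDiffOn (𝓡 m) (𝓡 m).tangent ∞
        (fun y : EuclideanSpace ℝ (Fin m) ↦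
          (⟨y, v⟩ : TangentBundle (𝓡 m) (EuclideanSpace ℝ (Fin m))))
        (extChartAt (𝓡 m) x₀).target := by
      apply ContMDiff.contMDiffOn
      exact contMDiff_vectorSpace_iff_contDiff.2 contDiff_const
    have h3 := h1.comp h2 (fun y hy ↦ hy)
    refine h3.congr fun y hy ↦ ?_
    simp only [Function.comp_apply, tangentMapWithin]
    rw [mfderivWithin_of_isOpen (isOpen_extChartAt_target x₀) hy]
    rfl
  have := ContMDiffOn.inner_bundle (key v) (key w)
  rw [← contMDiffOn_iff_contDiffOn]
  exact this

/-- The Riemannian metric in the chart at `x₀`, as a continuous bilinear form. -/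
def metricForm (x₀ : M) (y : EuclideanSpace ℝ (Fin m)) :
    EuclideanSpace ℝ (Fin m) →L[ℝ] EuclideanSpace ℝ (Fin m) →L[ℝ] ℝ :=
  (innerSL ℝ).bilinearComp (chartSymmDiff x₀ y) (chartSymmDiff x₀ y)

theorem metricForm_apply (x₀ : M) (y v w : EuclideanSpace ℝ (Fin m)) :
    metricForm x₀ y v w = metricInChart x₀ y v w := rfl

theorem metricForm_comm (x₀ : M) (y v w : EuclideanSpace ℝ (Fin m)) :
    metricForm x₀ y v w = metricForm x₀ y w v :=
  real_inner_comm (chartSymmDiff x₀ y w) (chartSymmDiff x₀ y v)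

theorem contDiffOn_metricForm (x₀ : M) :
    ContDiffOn ℝ ∞ (metricForm (m := m) x₀) (extChartAt (𝓡 m) x₀).target := by
  rw [contDiffOn_clm_apply]
  intro v
  rw [contDiffOn_clm_apply]
  intro w
  exact contDiffOn_metricInChart x₀ v w

theorem differentiableAt_metricForm {x₀ : M} {y : EuclideanSpace ℝ (Fin m)}
    (hy : y ∈ (extChartAt (𝓡 m) x₀).target) : DifferentiableAt ℝ (metricForm (m := m) x₀) y :=
  ((contDiffOn_metricForm x₀).differentiableOn (by simp) y hy).differentiableAt
    ((isOpen_extChartAt_target x₀).mem_nhds hy)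

theorem fderiv_metricInChart {x₀ : M} {y : EuclideanSpace ℝ (Fin m)}
    (hy : y ∈ (extChartAt (𝓡 m) x₀).target) (u v w : EuclideanSpace ℝ (Fin m)) :
    fderiv ℝ (fun z ↦ metricInChart x₀ z v w) y u = fderiv ℝ (metricForm x₀) y u v w := by
  have h := (((differentiableAt_metricForm hy).hasFDerivAt.clm_apply
    (hasFDerivAt_const v y)).clm_apply (hasFDerivAt_const w y)).fderiv
  simp only [metricForm_apply] at h
  rw [h]
  simp

theorem christoffelForm_fderiv_apply {x₀ : M} {y : EuclideanSpace ℝ (Fin m)}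
    (hy : y ∈ (extChartAt (𝓡 m) x₀).target) (u v w : EuclideanSpace ℝ (Fin m)) :
    christoffelForm (fderiv ℝ (metricForm x₀) y) u v w = christoffelInChart x₀ y u v w := by
  simp only [christoffelForm_apply, christoffelInChart, fderiv_metricInChart hy]

theorem metricInChart_chartDiff {x₀ q : M} (hq : q ∈ (extChartAt (𝓡 m) x₀).source)
    (u v : TangentSpace (𝓡 m) q) :
    metricInChart x₀ (extChartAt (𝓡 m) x₀ q) (chartDiff x₀ q u) (chartDiff x₀ q v)
      = inner ℝ u v := by
  obtain ⟨y, hy, rfl⟩ : ∃ y ∈ (extChartAt (𝓡 m) x₀).target, (extChartAt (𝓡 m) x₀).symm y = q :=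
    ⟨_, (extChartAt (𝓡 m) x₀).map_source hq, (extChartAt (𝓡 m) x₀).left_inv hq⟩
  rw [(extChartAt (𝓡 m) x₀).right_inv hy]
  change inner ℝ (chartSymmDiff x₀ y _) (chartSymmDiff x₀ y _) = _
  rw [chartSymmDiff_chartDiff hy, chartSymmDiff_chartDiff hy]

theorem metricForm_injective {x₀ : M} {y : EuclideanSpace ℝ (Fin m)}
    (hy : y ∈ (extChartAt (𝓡 m) x₀).target) : Function.Injective (metricForm x₀ y) := by
  rw [injective_iff_map_eq_zero]
  intro v hv
  have h1 : inner ℝ (chartSymmDiff x₀ y v) (chartSymmDiff x₀ y v) = 0 :=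
    congr($hv v)
  rw [inner_self_eq_zero] at h1
  rw [← chartDiff_chartSymmDiff hy v, h1, map_zero]

end Chart

/-! ### Speed and length of geodesics -/

section Geodesic

variable {m : ℕ} {M : Type*} [EMetricSpace M] [ChartedSpace (EuclideanSpace ℝ (Fin m)) M]
  [IsManifold (𝓡 m) ∞ M]

theorem hasDerivWithinAt_curveInChart {γ : ℝ → M} {x₀ : M} {t : ℝ}
    (hγ : ContMDiffOn 𝓘(ℝ, ℝ) (𝓡 m) ∞ γ (Icc 0 1)) (ht : t ∈ Icc (0 : ℝ) 1)
    (hx₀ : γ t ∈ (extChartAt (𝓡 m) x₀).source) :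
    HasDerivWithinAt (curveInChart (m := m) x₀ γ)
      (chartDiff x₀ (γ t) (mfderivWithin 𝓘(ℝ, ℝ) (𝓡 m) γ (Icc 0 1) t (1 : ℝ))) (Icc 0 1) t := by
  have h1 : MDifferentiableWithinAt 𝓘(ℝ, ℝ) (𝓡 m) γ (Icc 0 1) t :=
    hγ.mdifferentiableOn (by simp) t ht
  have h2 : MDifferentiableAt (𝓡 m) (𝓡 m) (extChartAt (𝓡 m) x₀) (γ t) :=
    mdifferentiableAt_extChartAt (by rwa [extChartAt_source] at hx₀)
  have h3 := h2.hasMFDerivAt.comp_hasMFDerivWithinAt t h1.hasMFDerivWithinAt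
  have h4 : HasFDerivWithinAt (curveInChart (m := m) x₀ γ)
      ((chartDiff x₀ (γ t)).comp (mfderivWithin 𝓘(ℝ, ℝ) (𝓡 m) γ (Icc 0 1) t) :
        ℝ →L[ℝ] EuclideanSpace ℝ (Fin m)) (Icc 0 1) t := h3.hasFDerivWithinAt
  exact h4.hasDerivWithinAt

theorem eventually_mem_chart_source {γ : ℝ → M} {x₀ : M} {t : ℝ}
    (hγ : ContMDiffOn 𝓘(ℝ, ℝ) (𝓡 m) ∞ γ (Icc 0 1)) (ht : t ∈ Icc (0 : ℝ) 1)
    (hx₀ : γ t ∈ (extChartAt (𝓡 m) x₀).source) :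
    ∀ᶠ s in 𝓝[Icc 0 1] t, γ s ∈ (extChartAt (𝓡 m) x₀).source :=
  (hγ.continuousOn t ht).eventually_mem ((isOpen_extChartAt_source x₀).mem_nhds hx₀)

variable [RiemannianBundle (fun x : M ↦ TangentSpace (𝓡 m) x)]
    [IsContMDiffRiemannianBundle (𝓡 m) ∞ (EuclideanSpace ℝ (Fin m))
      (fun x : M ↦ TangentSpace (𝓡 m) x)]

/-- The energy density of a geodesic is constant. -/
theorem IsGeodesic.hasDerivWithinAt_inner_velocity {γ : ℝ → M} (hγ : IsGeodesic m γ) {t : ℝ}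
    (ht : t ∈ Icc (0 : ℝ) 1) :
    HasDerivWithinAt (fun s ↦ inner ℝ (mfderivWithin 𝓘(ℝ, ℝ) (𝓡 m) γ (Icc 0 1) s (1 : ℝ))
      (mfderivWithin 𝓘(ℝ, ℝ) (𝓡 m) γ (Icc 0 1) s (1 : ℝ))) 0 (Icc 0 1) t := by
  obtain ⟨hsm, -, hpar⟩ := hγ
  obtain ⟨x₀, hx₀, hc, hV, heq⟩ := hpar t ht
  have hx₀' : γ t ∈ (extChartAt (𝓡 m) x₀).source := by rwa [extChartAt_source]
  set c := curveInChart (m := m) x₀ γ with hcdef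
  set V := fieldInChart x₀ (velocity (m := m) γ) with hVdef
  have hct : c t ∈ (extChartAt (𝓡 m) x₀).target := (extChartAt (𝓡 m) x₀).map_source hx₀'
  have hcV : derivWithin c (Icc 0 1) t = V t :=
    (hasDerivWithinAt_curveInChart hsm ht hx₀').derivWithin (uniqueDiffOn_Icc zero_lt_one t ht)
  have hN : ∀ᶠ s in 𝓝[Icc 0 1] t,
      inner ℝ (mfderivWithin 𝓘(ℝ, ℝ) (𝓡 m) γ (Icc 0 1) s (1 : ℝ))
        (mfderivWithin 𝓘(ℝ, ℝ) (𝓡 m) γ (Icc 0 1) s (1 : ℝ)) = metricForm x₀ (c s) (V s) (V s) := by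
    filter_upwards [eventually_mem_chart_source hsm ht hx₀'] with s hs
    exact (metricInChart_chartDiff hs _ _).symm
  have hG := (((differentiableAt_metricForm hct).hasFDerivAt.comp_hasDerivWithinAt t
    hc.hasDerivWithinAt).clm_apply hV.hasDerivWithinAt).clm_apply hV.hasDerivWithinAt
  refine (hG.congr_of_eventuallyEq hN (hN.self_of_nhdsWithin ht)).congr_deriv ?_
  -- Testing with `w = V t`, two of the three Christoffel terms cancel: what remains is half the
  -- derivative of the metric, exactly the term needed to annihilate the derivative of the energy.
  have h0 := heq (V t)
  change metricInChart x₀ (c t) (derivWithin V (Icc 0 1) t) (V t) +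
    christoffelInChart x₀ (c t) (derivWithin c (Icc 0 1) t) (V t) (V t) = 0 at h0
  rw [← christoffelForm_fderiv_apply hct, christoffelForm_apply, ← metricForm_apply] at h0
  change (fderiv ℝ (metricForm x₀) (c t) (derivWithin c (Icc 0 1) t) (V t) +
    metricForm x₀ (c t) (derivWithin V (Icc 0 1) t)) (V t) +
      metricForm x₀ (c t) (V t) (derivWithin V (Icc 0 1) t) = 0
  rw [hcV] at h0 ⊢
  rw [add_apply, metricForm_comm x₀ (c t) (V t)]
  linarith

theorem IsGeodesic.norm_velocity_eq {γ : ℝ → M} (hγ : IsGeodesic m γ) {t : ℝ}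
    (ht : t ∈ Icc (0 : ℝ) 1) :
    ‖mfderivWithin 𝓘(ℝ, ℝ) (𝓡 m) γ (Icc 0 1) t (1 : ℝ)‖
      = ‖mfderivWithin 𝓘(ℝ, ℝ) (𝓡 m) γ (Icc 0 1) 0 (1 : ℝ)‖ := by
  have h := constant_of_derivWithin_zero
    (fun s hs ↦ (hγ.hasDerivWithinAt_inner_velocity hs).differentiableWithinAt)
    (fun s hs ↦ (hγ.hasDerivWithinAt_inner_velocity (Ico_subset_Icc_self hs)).derivWithin
      (uniqueDiffOn_Icc zero_lt_one s (Ico_subset_Icc_self hs))) t ht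
  simp only [real_inner_self_eq_norm_sq] at h
  exact (sq_eq_sq₀ (norm_nonneg _) (norm_nonneg _)).1 h

/-- The speed is constant and the parameter interval has length one, so the speed is the length. -/
theorem IsMinimalGeodesic.enorm_velocity_eq {γ : ℝ → M} {x y : M}
    (hγ : IsMinimalGeodesic m γ x y) {t : ℝ} (ht : t ∈ Icc (0 : ℝ) 1) :
    ‖mfderivWithin 𝓘(ℝ, ℝ) (𝓡 m) γ (Icc 0 1) t (1 : ℝ)‖ₑ = edist x y := by
  obtain ⟨hg, -, -, hl⟩ := hγ
  rw [← hl, Manifold.pathELength_eq_lintegral_mfderivWithin_Icc]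
  have h1 : ∀ s ∈ Icc (0 : ℝ) 1, ‖mfderivWithin 𝓘(ℝ, ℝ) (𝓡 m) γ (Icc 0 1) s (1 : ℝ)‖ₑ
      = ‖mfderivWithin 𝓘(ℝ, ℝ) (𝓡 m) γ (Icc 0 1) t (1 : ℝ)‖ₑ := by
    intro s hs
    rw [← ofReal_norm, ← ofReal_norm, hg.norm_velocity_eq hs, hg.norm_velocity_eq ht]
  refine ((setLIntegral_congr_fun measurableSet_Icc h1).trans ?_).symm
  simp

/-- An initial piece of the curve is no longer than the whole. This keeps minimal geodesics from the
centre of a ball inside it. -/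
theorem IsMinimalGeodesic.edist_le [IsRiemannianManifold (𝓡 m) M] {γ : ℝ → M} {x y : M}
    (hγ : IsMinimalGeodesic m γ x y) {t : ℝ} (ht : t ∈ Icc (0 : ℝ) 1) :
    edist x (γ t) ≤ edist x y := by
  obtain ⟨hg, h0, -, hl⟩ := hγ
  rw [← hl, IsRiemannianManifold.out (I := 𝓡 m) x (γ t)]
  refine (Manifold.riemannianEDist_le_pathELength (γ := γ) ?_ h0 rfl ht.1).trans
    (Manifold.pathELength_mono le_rfl ht.2)
  exact (hg.1.of_le (by simp)).mono (Icc_subset_Icc le_rfl ht.2)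

end Geodesic

/-! ### Parallel transport as a linear differential equation -/

section ParallelTransport

variable {m : ℕ} {M : Type*} [EMetricSpace M] [ChartedSpace (EuclideanSpace ℝ (Fin m)) M]
  [IsManifold (𝓡 m) ∞ M]

/-- The tangent vector at `q` with components `u` in the chart at `x₀`. -/
def vectorOfChart (x₀ : M) (u : EuclideanSpace ℝ (Fin m)) (q : M) : TangentBundle (𝓡 m) M :=
  ⟨q, (chartDiff x₀ q).inverse u⟩

theorem chartDiff_inverse {x₀ q : M} (hq : q ∈ (extChartAt (𝓡 m) x₀).source)
    (u : EuclideanSpace ℝ (Fin m)) : chartDiff x₀ q ((chartDiff x₀ q).inverse u) = u :=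
  (isInvertible_mfderiv_extChartAt hq).self_apply_inverse u

theorem inverse_chartDiff {x₀ q : M} (hq : q ∈ (extChartAt (𝓡 m) x₀).source)
    (u : TangentSpace (𝓡 m) q) : (chartDiff x₀ q).inverse (chartDiff x₀ q u) = u :=
  (isInvertible_mfderiv_extChartAt hq).inverse_apply_self u

variable [RiemannianBundle (fun x : M ↦ TangentSpace (𝓡 m) x)]
    [IsContMDiffRiemannianBundle (𝓡 m) ∞ (EuclideanSpace ℝ (Fin m))
      (fun x : M ↦ TangentSpace (𝓡 m) x)]

/-- Positive definiteness gives injectivity, and a space and its dual have the same dimension. -/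
theorem exists_equiv_eq_metricForm {x₀ : M} {y : EuclideanSpace ℝ (Fin m)}
    (hy : y ∈ (extChartAt (𝓡 m) x₀).target) :
    ∃ e : EuclideanSpace ℝ (Fin m) ≃L[ℝ] (EuclideanSpace ℝ (Fin m) →L[ℝ] ℝ),
      (e : EuclideanSpace ℝ (Fin m) →L[ℝ] EuclideanSpace ℝ (Fin m) →L[ℝ] ℝ)
        = metricForm x₀ y := by
  have hdim : Module.finrank ℝ (EuclideanSpace ℝ (Fin m))
      = Module.finrank ℝ (EuclideanSpace ℝ (Fin m) →L[ℝ] ℝ) := by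
    rw [← (LinearMap.toContinuousLinearMap (𝕜 := ℝ) (E := EuclideanSpace ℝ (Fin m))
      (F' := ℝ)).finrank_eq]
    exact (Subspace.dual_finrank_eq (K := ℝ) (V := EuclideanSpace ℝ (Fin m))).symm
  refine ⟨(LinearMap.linearEquivOfInjective (metricForm x₀ y).toLinearMap
    (metricForm_injective hy) hdim).toContinuousLinearEquiv, ?_⟩
  ext v w
  rfl

theorem continuousAt_inverse_metricForm {x₀ : M} {y : EuclideanSpace ℝ (Fin m)}
    (hy : y ∈ (extChartAt (𝓡 m) x₀).target) :
    ContinuousAt (fun y ↦ (metricForm (m := m) x₀ y).inverse) y := by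
  obtain ⟨e, he⟩ := exists_equiv_eq_metricForm hy
  have h1 : ContinuousAt ContinuousLinearMap.inverse (metricForm (m := m) x₀ y) := by
    rw [← he]
    exact (contDiffAt_map_inverse (n := 0) e).continuousAt
  exact ContinuousAt.comp (f := metricForm (m := m) x₀) h1
    (differentiableAt_metricForm hy).continuousAt

theorem metricForm_inverse_apply {x₀ : M} {y : EuclideanSpace ℝ (Fin m)}
    (hy : y ∈ (extChartAt (𝓡 m) x₀).target) (l : EuclideanSpace ℝ (Fin m) →L[ℝ] ℝ) :
    metricForm x₀ y ((metricForm x₀ y).inverse l) = l := by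
  obtain ⟨e, he⟩ := exists_equiv_eq_metricForm hy
  rw [← he, ContinuousLinearMap.inverse_equiv]
  simp

theorem inverse_metricForm_apply {x₀ : M} {y : EuclideanSpace ℝ (Fin m)}
    (hy : y ∈ (extChartAt (𝓡 m) x₀).target) (u : EuclideanSpace ℝ (Fin m)) :
    (metricForm x₀ y).inverse (metricForm x₀ y u) = u := by
  obtain ⟨e, he⟩ := exists_equiv_eq_metricForm hy
  rw [← he, ContinuousLinearMap.inverse_equiv]
  simp

theorem continuousAt_fderiv_metricForm {x₀ : M} {y : EuclideanSpace ℝ (Fin m)}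
    (hy : y ∈ (extChartAt (𝓡 m) x₀).target) :
    ContinuousAt (fderiv ℝ (metricForm (m := m) x₀)) y :=
  ((contDiffOn_metricForm x₀).continuousOn_fderiv_of_isOpen (isOpen_extChartAt_target x₀)
    (by simp)).continuousAt ((isOpen_extChartAt_target x₀).mem_nhds hy)

/-- Parallel fields along a curve in the domain of the chart at `x₀`, if the coefficients of the
equation of parallel transport are small. -/
theorem exists_parallel_of_small {x₀ : M} {γ : ℝ → M}
    (hγ : ContMDiffOn 𝓘(ℝ, ℝ) (𝓡 m) ∞ γ (Icc 0 1))
    (hs : ∀ t ∈ Icc (0 : ℝ) 1, γ t ∈ (extChartAt (𝓡 m) x₀).source) {k : ℝ} (hk : k ≤ 1 / 2)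
    (hbd : ∀ t ∈ Icc (0 : ℝ) 1, ‖(metricForm (m := m) x₀ (curveInChart x₀ γ t)).inverse‖ *
      (3 / 2 * ‖fderiv ℝ (metricForm (m := m) x₀) (curveInChart x₀ γ t)‖ *
        ‖derivWithin (curveInChart (m := m) x₀ γ) (Icc 0 1) t‖) ≤ k) :
    ∃ T : EuclideanSpace ℝ (Fin m) →L[ℝ] EuclideanSpace ℝ (Fin m), ‖T - 1‖ ≤ 2 * k ∧
      ∀ u, ∃ V : ℝ → TangentBundle (𝓡 m) M, IsParallelAlong γ V ∧
        V 0 = vectorOfChart x₀ u (γ 0) ∧ V 1 = vectorOfChart x₀ (T u) (γ 1) := by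
  set c := curveInChart (m := m) x₀ γ with hc
  have hct : ∀ t ∈ Icc (0 : ℝ) 1, c t ∈ (extChartAt (𝓡 m) x₀).target :=
    fun t ht ↦ (extChartAt (𝓡 m) x₀).map_source (hs t ht)
  have hcsm : ContDiffOn ℝ ∞ c (Icc 0 1) := by
    rw [← contMDiffOn_iff_contDiffOn]
    have h1 : ContMDiffOn (𝓡 m) (𝓡 m) ∞ (extChartAt (𝓡 m) x₀) (extChartAt (𝓡 m) x₀).source := by
      rw [extChartAt_source]
      exact contMDiffOn_extChartAt
    exact h1.comp hγ hs
  have hc' : ContinuousOn (derivWithin c (Icc 0 1)) (Icc 0 1) :=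
    hcsm.continuousOn_derivWithin (uniqueDiffOn_Icc zero_lt_one) (by simp)
  -- Raising the index in `g(v', ·) + Γ(c', v, ·) = 0` turns the equation into `v' = A v`.
  set A : ℝ → EuclideanSpace ℝ (Fin m) →L[ℝ] EuclideanSpace ℝ (Fin m) := fun t ↦
    -((metricForm (m := m) x₀ (c t)).inverse.comp
      (christoffelForm (fderiv ℝ (metricForm (m := m) x₀) (c t)) (derivWithin c (Icc 0 1) t)))
    with hA
  have hAc : ContinuousOn A (Icc 0 1) := by
    intro t ht
    have h1 : ContinuousWithinAt (fun t ↦ (metricForm (m := m) x₀ (c t)).inverse) (Icc 0 1) t :=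
      (continuousAt_inverse_metricForm (hct t ht)).comp_continuousWithinAt
        (hcsm.continuousOn t ht)
    have h2 : ContinuousWithinAt (fun t ↦ fderiv ℝ (metricForm (m := m) x₀) (c t)) (Icc 0 1) t :=
      (continuousAt_fderiv_metricForm (hct t ht)).comp_continuousWithinAt (hcsm.continuousOn t ht)
    have h3 := (continuous_christoffelForm (E := EuclideanSpace ℝ (Fin m))).continuousAt
      |>.comp_continuousWithinAt (h2.prodMk (hc' t ht))
    exact (h1.clm_comp h3).neg
  have hAk : ∀ t ∈ Icc (0 : ℝ) 1, ‖A t‖ ≤ k := by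
    intro t ht
    refine le_trans ?_ (hbd t ht)
    rw [hA, norm_neg]
    refine (ContinuousLinearMap.opNorm_comp_le _ _).trans ?_
    gcongr
    exact norm_christoffelForm_le _ _
  -- Solving for operators gives all initial vectors at once, linearly. The identity has norm at
  -- most `1`, with equality failing in dimension zero.
  obtain ⟨T, hT0, hT, hT1⟩ := exists_fundamentalSolution
    (B := EuclideanSpace ℝ (Fin m) →L[ℝ] EuclideanSpace ℝ (Fin m))
    ContinuousLinearMap.norm_id_le hAc hk hAk
  refine ⟨T 1, hT1, fun u ↦ ⟨fun t ↦ vectorOfChart x₀ (T t u) (γ t),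
    ⟨hγ, fun _ ↦ rfl, fun t ht ↦ ⟨x₀, ?_, ?_, ?_, fun w ↦ ?_⟩⟩, ?_, rfl⟩⟩
  · have := hs t ht
    rwa [extChartAt_source] at this
  · exact hcsm.differentiableOn (by simp) t ht
  on_goal 3 => simp [hT0]
  all_goals
    have hf : ∀ t ∈ Icc (0 : ℝ) 1,
        fieldInChart x₀ (fun t ↦ vectorOfChart x₀ (T t u) (γ t)) t = T t u :=
      fun t ht ↦ chartDiff_inverse (hs t ht) _
    have hd : HasDerivWithinAt (fieldInChart x₀ (fun t ↦ vectorOfChart x₀ (T t u) (γ t)))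
        ((A t * T t) u) (Icc 0 1) t :=
      HasDerivWithinAt.congr (by simpa using (hT t ht).clm_apply (hasDerivWithinAt_const t _ u))
        hf (hf t ht)
  · exact hd.differentiableWithinAt
  · rw [hf t ht, hd.derivWithin (uniqueDiffOn_Icc zero_lt_one t ht)]
    change metricInChart x₀ (c t) _ w + christoffelInChart x₀ (c t) (derivWithin c (Icc 0 1) t)
      (T t u) w = 0
    rw [← metricForm_apply, ← christoffelForm_fderiv_apply (hct t ht)]
    have : (A t * T t) u = -((metricForm (m := m) x₀ (c t)).inverse
      (christoffelForm (fderiv ℝ (metricForm (m := m) x₀) (c t)) (derivWithin c (Icc 0 1) t)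
        (T t u))) := rfl
    rw [this, map_neg, metricForm_inverse_apply (hct t ht)]
    simp

end ParallelTransport

/-! ### Uniform bounds near a point and parallel translation -/

section NearPoint

variable {m : ℕ} {M : Type*} [EMetricSpace M] [ChartedSpace (EuclideanSpace ℝ (Fin m)) M]
  [IsManifold (𝓡 m) ∞ M] [RiemannianBundle (fun x : M ↦ TangentSpace (𝓡 m) x)]
    [IsContMDiffRiemannianBundle (𝓡 m) ∞ (EuclideanSpace ℝ (Fin m))
      (fun x : M ↦ TangentSpace (𝓡 m) x)]

theorem norm_chartSymmDiff_sq (x₀ : M) (y u : EuclideanSpace ℝ (Fin m)) :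
    ‖chartSymmDiff x₀ y u‖ ^ 2 = metricForm x₀ y u u :=
  (real_inner_self_eq_norm_sq (chartSymmDiff x₀ y u)).symm

/-- Near the centre of a chart the Euclidean and the Riemannian norms are equivalent, and the
coefficients of the Levi-Civita connection are bounded. -/
theorem exists_bounds_near (p : M) : ∃ K : ℝ, 0 < K ∧ ∀ᶠ y in 𝓝 (extChartAt (𝓡 m) p p),
    y ∈ (extChartAt (𝓡 m) p).target ∧ ‖(metricForm (m := m) p y).inverse‖ ≤ K ∧
    ‖fderiv ℝ (metricForm (m := m) p) y‖ ≤ K ∧ (∀ u, ‖chartSymmDiff p y u‖ ≤ K * ‖u‖) ∧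
      ∀ u, ‖u‖ ≤ K * ‖chartSymmDiff p y u‖ := by
  have hp : extChartAt (𝓡 m) p p ∈ (extChartAt (𝓡 m) p).target := mem_extChartAt_target p
  have h1 := (continuousAt_inverse_metricForm hp).norm.eventually_lt_const (lt_add_one _)
  have h2 := (continuousAt_fderiv_metricForm hp).norm.eventually_lt_const (lt_add_one _)
  have h3 := (differentiableAt_metricForm hp).continuousAt.norm.eventually_lt_const (lt_add_one _)
  set K₁ := ‖(metricForm (m := m) p (extChartAt (𝓡 m) p p)).inverse‖ + 1
  set K₂ := ‖fderiv ℝ (metricForm (m := m) p) (extChartAt (𝓡 m) p p)‖ + 1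
  set K₃ := ‖metricForm (m := m) p (extChartAt (𝓡 m) p p)‖ + 1
  have hK₁ : 0 < K₁ := by positivity
  have hK₂ : 0 < K₂ := by positivity
  have hK₃ : 0 < K₃ := by positivity
  refine ⟨K₁ + K₂ + √K₃ + K₁ * √K₃, by positivity, ?_⟩
  filter_upwards [h1, h2, h3, (isOpen_extChartAt_target p).mem_nhds hp] with y h1 h2 h3 hy
  have hle : ∀ u, ‖chartSymmDiff p y u‖ ≤ √K₃ * ‖u‖ := by
    intro u
    refine abs_le_of_sq_le_sq' ?_ (by positivity) |>.2
    rw [norm_chartSymmDiff_sq, mul_pow, Real.sq_sqrt hK₃.le, sq]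
    calc metricForm p y u u ≤ ‖metricForm p y u u‖ := Real.le_norm_self _
      _ ≤ ‖metricForm (m := m) p y‖ * ‖u‖ * ‖u‖ := ContinuousLinearMap.le_opNorm₂ _ _ _
      _ ≤ K₃ * (‖u‖ * ‖u‖) := by rw [mul_assoc]; gcongr
  have hpos : 0 ≤ √K₃ := Real.sqrt_nonneg _
  have hpos' : 0 ≤ K₁ * √K₃ := by positivity
  refine ⟨hy, by linarith, by linarith, fun u ↦ (hle u).trans ?_, fun u ↦ ?_⟩
  · gcongr
    linarith
  · have h4 : ‖metricForm (m := m) p y u‖ ≤ √K₃ * ‖chartSymmDiff p y u‖ := by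
      refine ContinuousLinearMap.opNorm_le_bound _ (by positivity) fun w ↦ ?_
      have h5 := norm_inner_le_norm (𝕜 := ℝ) (chartSymmDiff p y u) (chartSymmDiff p y w)
      calc ‖metricForm (m := m) p y u w‖ ≤ ‖chartSymmDiff p y u‖ * ‖chartSymmDiff p y w‖ := h5
        _ ≤ ‖chartSymmDiff p y u‖ * (√K₃ * ‖w‖) := by gcongr; exact hle w
        _ = √K₃ * ‖chartSymmDiff p y u‖ * ‖w‖ := by ring
    calc ‖u‖ = ‖(metricForm p y).inverse (metricForm p y u)‖ := by
          rw [inverse_metricForm_apply hy]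
      _ ≤ ‖(metricForm (m := m) p y).inverse‖ * ‖metricForm (m := m) p y u‖ :=
          ContinuousLinearMap.le_opNorm _ _
      _ ≤ K₁ * (√K₃ * ‖chartSymmDiff p y u‖) := by gcongr
      _ = K₁ * √K₃ * ‖chartSymmDiff p y u‖ := by ring
      _ ≤ _ := by
        gcongr
        linarith

theorem norm_chartDiff_le {p q : M} {K : ℝ} (hq : q ∈ (extChartAt (𝓡 m) p).source)
    (hK : ∀ u, ‖u‖ ≤ K * ‖chartSymmDiff (m := m) p (extChartAt (𝓡 m) p q) u‖)
    (v : TangentSpace (𝓡 m) q) : ‖chartDiff p q v‖ ≤ K * ‖v‖ := by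
  refine (hK _).trans (le_of_eq ?_)
  congr 1
  rw [← sq_eq_sq₀ (norm_nonneg _) (norm_nonneg _), norm_chartSymmDiff_sq, metricForm_apply,
    metricInChart_chartDiff hq, real_inner_self_eq_norm_sq]

variable [IsRiemannianManifold (𝓡 m) M]

/-- Near `p`, the parallel translation from `p` is close to the identity in the chart at `p`. -/
theorem exists_parallelTranslation_near {p : M} {r : ℝ} (hr : IsConvexRadius m p r) :
    ∃ C : ℝ, ∀ᶠ x in 𝓝 p, ∃ (τ : TangentSpace (𝓡 m) p →L[ℝ] TangentSpace (𝓡 m) x)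
      (T : EuclideanSpace ℝ (Fin m) →L[ℝ] EuclideanSpace ℝ (Fin m)),
      IsParallelTranslation p x τ ∧ (∀ v, chartDiff p x (τ v) = T (chartDiff p p v)) ∧
        ‖T - 1‖ ≤ C * (edist p x).toReal := by
  obtain ⟨K, hK, hev⟩ := exists_bounds_near (m := m) p
  -- One factor `K` bounds the inverse metric, `3 / 2 * K` the Christoffel form, and the last `K`
  -- compares the speed in the chart with the Riemannian speed, which is the distance from `p` to
  -- `x`.
  set C := K * (3 / 2 * K * K)
  refine ⟨2 * C, ?_⟩
  have hev' : ∀ᶠ q in 𝓝 p, q ∈ (extChartAt (𝓡 m) p).source ∧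
      extChartAt (𝓡 m) p q ∈ {y | y ∈ (extChartAt (𝓡 m) p).target ∧
        ‖(metricForm (m := m) p y).inverse‖ ≤ K ∧ ‖fderiv ℝ (metricForm (m := m) p) y‖ ≤ K ∧
        (∀ u, ‖chartSymmDiff p y u‖ ≤ K * ‖u‖) ∧ ∀ u, ‖u‖ ≤ K * ‖chartSymmDiff p y u‖} :=
    Filter.Eventually.and (extChartAt_source_mem_nhds (I := 𝓡 m) p)
      ((continuousAt_extChartAt p).eventually hev)
  obtain ⟨δ, hδ, hδs⟩ := Metric.nhds_basis_eball.mem_iff.1 hev'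
  have hr0 : (0 : ℝ≥0∞) < ENNReal.ofReal r := ENNReal.ofReal_pos.2 hr.1
  -- Within this distance the coefficients are at most `1 / 2`, as `exists_parallel_of_small`
  -- demands.
  have hsmall : (0 : ℝ≥0∞) < ENNReal.ofReal (1 / (2 * C)) := ENNReal.ofReal_pos.2 (by positivity)
  filter_upwards [Metric.eball_mem_nhds p hδ, Metric.eball_mem_nhds p hr0,
    Metric.eball_mem_nhds p hsmall] with x hxδ hxr hxC
  rw [Metric.mem_eball'] at hxδ hxC
  obtain ⟨γ, hγ, -⟩ := hr.2.1 p (subset_closure (Metric.mem_eball_self hr0)) x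
    (subset_closure hxr)
  have hmin := hγ.1
  have hmem : ∀ t ∈ Icc (0 : ℝ) 1, γ t ∈ Metric.eball p δ := fun t ht ↦ by
    rw [Metric.mem_eball']
    exact (hmin.edist_le ht).trans_lt hxδ
  have hsp : ∀ t ∈ Icc (0 : ℝ) 1,
      ‖mfderivWithin 𝓘(ℝ, ℝ) (𝓡 m) γ (Icc 0 1) t (1 : ℝ)‖ = (edist p x).toReal := fun t ht ↦ by
    rw [← hmin.enorm_velocity_eq ht, toReal_enorm]
  have hk : C * (edist p x).toReal ≤ 1 / 2 := by
    have h1 := (ENNReal.toReal_lt_of_lt_ofReal hxC).le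
    rw [le_div_iff₀ (by positivity)] at h1
    linarith
  obtain ⟨T, hT, hpar⟩ := exists_parallel_of_small (x₀ := p) hmin.1.1
    (fun t ht ↦ (hδs (hmem t ht)).1) hk (fun t ht ↦ by
      obtain ⟨hsrc, -, h1, h2, -, h3⟩ := hδs (hmem t ht)
      rw [(hasDerivWithinAt_curveInChart hmin.1.1 ht hsrc).derivWithin
        (uniqueDiffOn_Icc zero_lt_one t ht)]
      have h4 := norm_chartDiff_le hsrc h3
        (mfderivWithin 𝓘(ℝ, ℝ) (𝓡 m) γ (Icc 0 1) t (1 : ℝ))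
      rw [hsp t ht] at h4
      calc _ ≤ K * (3 / 2 * K * (K * (edist p x).toReal)) := by
            gcongr
            · exact h1
            · exact h2
        _ = C * (edist p x).toReal := by ring)
  have hxs : x ∈ (extChartAt (𝓡 m) p).source := by
    rw [← hmin.2.2.1]
    exact (hδs (hmem 1 (by simp))).1
  refine ⟨(chartDiff p x).inverse.comp (T.comp (chartDiff p p)), T,
    ⟨γ, hγ, fun v ↦ ?_⟩, fun v ↦ chartDiff_inverse hxs _, by rw [mul_assoc]; exact hT⟩
  obtain ⟨V, hV, hV0, hV1⟩ := hpar (chartDiff p p v)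
  refine ⟨V, hV, ?_, ?_⟩
  · rw [hV0, hmin.2.1, vectorOfChart, inverse_chartDiff (mem_extChartAt_source p)]
  · rw [hV1, hmin.2.2.1]
    rfl

end NearPoint

/-! ### Derivatives and Lipschitz bounds in a chart -/

section ChartLipschitz

variable {m : ℕ} {M : Type*} [EMetricSpace M] [ChartedSpace (EuclideanSpace ℝ (Fin m)) M]
  [IsManifold (𝓡 m) ∞ M]

theorem hasFDerivAt_comp_extChartAt_symm {F : M → ℝ} {p : M} {y : EuclideanSpace ℝ (Fin m)}
    (hy : y ∈ (extChartAt (𝓡 m) p).target)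
    (hF : MDifferentiableAt (𝓡 m) 𝓘(ℝ, ℝ) F ((extChartAt (𝓡 m) p).symm y)) :
    HasFDerivAt (fun z ↦ F ((extChartAt (𝓡 m) p).symm z))
      ((differential m F ((extChartAt (𝓡 m) p).symm y)).comp (chartSymmDiff p y)) y := by
  have h := hF.hasMFDerivAt.comp y (mdifferentiableAt_extChartAt_symm hy).hasMFDerivAt
  exact h.hasFDerivAt

theorem differential_apply_eq_fderiv {F : M → ℝ} {p : M} {y : EuclideanSpace ℝ (Fin m)}
    (hy : y ∈ (extChartAt (𝓡 m) p).target)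
    (hF : MDifferentiableAt (𝓡 m) 𝓘(ℝ, ℝ) F ((extChartAt (𝓡 m) p).symm y))
    (v : TangentSpace (𝓡 m) ((extChartAt (𝓡 m) p).symm y)) :
    differential m F ((extChartAt (𝓡 m) p).symm y) v =
      fderiv ℝ (fun z ↦ F ((extChartAt (𝓡 m) p).symm z)) y
        (chartDiff p ((extChartAt (𝓡 m) p).symm y) v) := by
  rw [(hasFDerivAt_comp_extChartAt_symm hy hF).fderiv, ContinuousLinearMap.comp_apply,
    chartSymmDiff_chartDiff hy]

variable [RiemannianBundle (fun x : M ↦ TangentSpace (𝓡 m) x)]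
    [IsContMDiffRiemannianBundle (𝓡 m) ∞ (EuclideanSpace ℝ (Fin m))
      (fun x : M ↦ TangentSpace (𝓡 m) x)] [IsRiemannianManifold (𝓡 m) M]

/-- The inverse chart maps a straight segment to a curve whose length is at most a constant times
that of the segment, and the Riemannian distance is bounded by lengths of curves. -/
theorem exists_edist_extChartAt_symm_le (p : M) : ∃ (C : ℝ≥0) (R : ℝ), 0 < R ∧
    Metric.ball (extChartAt (𝓡 m) p p) R ⊆ (extChartAt (𝓡 m) p).target ∧
    LipschitzOnWith C (extChartAt (𝓡 m) p).symm (Metric.ball (extChartAt (𝓡 m) p p) R) := by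
  obtain ⟨K, hK, hev⟩ := exists_bounds_near (m := m) p
  obtain ⟨R, hR, hRs⟩ := Metric.mem_nhds_iff.1 hev
  lift K to ℝ≥0 using hK.le
  refine ⟨K, R, hR, fun y hy ↦ (hRs hy).1, fun y hy y' hy' ↦ ?_⟩
  set η : ℝ → EuclideanSpace ℝ (Fin m) := fun t ↦ y + t • (y' - y) with hη
  have hηm : ∀ t ∈ Icc (0 : ℝ) 1, η t ∈ Metric.ball (extChartAt (𝓡 m) p p) R := fun t ht ↦
    (convex_ball _ R).add_smul_sub_mem hy hy' ht
  have hηd : ∀ t, HasFDerivAt η (ContinuousLinearMap.toSpanSingleton ℝ (y' - y)) t := by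
    intro t
    have : HasDerivAt η (y' - y) t := by
      rw [hη, hasDerivAt_const_add_iff]
      simpa using (hasDerivAt_id t).smul_const (y' - y)
    exact this.hasFDerivAt
  have hηs : ContDiff ℝ 1 η := by fun_prop
  set γ : ℝ → M := fun t ↦ (extChartAt (𝓡 m) p).symm (η t) with hγ
  have hγs : ContMDiffOn 𝓘(ℝ, ℝ) (𝓡 m) 1 γ (Icc 0 1) :=
    ((contMDiffOn_extChartAt_symm (n := ∞) p).of_le (by simp)).comp
      hηs.contMDiff.contMDiffOn fun t ht ↦ (hRs (hηm t ht)).1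
  rw [IsRiemannianManifold.out (I := 𝓡 m)]
  refine (Manifold.riemannianEDist_le_pathELength hγs (by simp [hγ, hη]) (by simp [hγ, hη])
    zero_le_one).trans ?_
  rw [Manifold.pathELength_eq_lintegral_mfderivWithin_Icc]
  have hbd : ∀ t ∈ Icc (0 : ℝ) 1, ‖mfderivWithin 𝓘(ℝ, ℝ) (𝓡 m) γ (Icc 0 1) t (1 : ℝ)‖ₑ
      ≤ K * edist y y' := by
    intro t ht
    have h1 := (mdifferentiableAt_extChartAt_symm (hRs (hηm t ht)).1).hasMFDerivAt
      |>.comp_hasMFDerivWithinAt t (hηd t).hasMFDerivAt.hasMFDerivWithinAt (s := Icc 0 1)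
    have h2 : mfderivWithin 𝓘(ℝ, ℝ) (𝓡 m) γ (Icc 0 1) t (1 : ℝ)
        = chartSymmDiff p (η t) (y' - y) := by
      have h3 := h1.mfderivWithin (uniqueDiffOn_Icc zero_lt_one t ht).uniqueMDiffWithinAt
      refine (congr($h3 (1 : ℝ))).trans ?_
      change chartSymmDiff p (η t) ((ContinuousLinearMap.toSpanSingleton ℝ (y' - y)) 1) = _
      simp
    have h4 := (hRs (hηm t ht)).2.2.2.1 (y' - y)
    rw [h2, ← ofReal_norm, edist_comm, edist_eq_enorm_sub, ← ofReal_norm]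
    refine (ENNReal.ofReal_le_ofReal h4).trans (le_of_eq ?_)
    rw [ENNReal.ofReal_mul hK.le, ENNReal.ofReal_coe_nnreal]
  refine (setLIntegral_mono' measurableSet_Icc hbd).trans (le_of_eq ?_)
  simp

end ChartLipschitz

/-! ### Limits of chart derivatives and the mixture -/

section Clarke

variable {m : ℕ} {M : Type*} [EMetricSpace M] [ChartedSpace (EuclideanSpace ℝ (Fin m)) M]
  [IsManifold (𝓡 m) ∞ M] [RiemannianBundle (fun x : M ↦ TangentSpace (𝓡 m) x)]
  [IsContMDiffRiemannianBundle (𝓡 m) ∞ (EuclideanSpace ℝ (Fin m))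
    (fun x : M ↦ TangentSpace (𝓡 m) x)] [IsRiemannianManifold (𝓡 m) M]

/-- Limits of the derivative of `F` in the chart at `p` along points outside `A` belong to the
mixture. -/
theorem comp_chartDiff_mem_mixture {F : M → ℝ} {p : M} {r : ℝ} {A : Set M}
    (hr : IsConvexRadius m p r)
    (hd : ∀ x ∈ Metric.eball p (ENNReal.ofReal r) \ A, MDifferentiableAt (𝓡 m) 𝓘(ℝ, ℝ) F x)
    {G : EuclideanSpace ℝ (Fin m) →L[ℝ] ℝ}
    (hG : MapClusterPt G (𝓝[(extChartAt (𝓡 m) p '' (A ∩ (extChartAt (𝓡 m) p).source))ᶜ]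
        (extChartAt (𝓡 m) p p)) (fderiv ℝ fun z ↦ F ((extChartAt (𝓡 m) p).symm z))) :
    G.comp (chartDiff p p) ∈ mixture m F p r A := by
  set N := extChartAt (𝓡 m) p '' (A ∩ (extChartAt (𝓡 m) p).source)
  set y₀ := extChartAt (𝓡 m) p p
  set g := fderiv ℝ fun z ↦ F ((extChartAt (𝓡 m) p).symm z)
  obtain ⟨C, hC⟩ := exists_parallelTranslation_near hr
  have hcont : ContinuousAt (extChartAt (𝓡 m) p).symm y₀ := continuousAt_extChartAt_symm p
  have hpy : (extChartAt (𝓡 m) p).symm y₀ = p := extChartAt_to_inv p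
  have htend : Tendsto (extChartAt (𝓡 m) p).symm (𝓝 y₀) (𝓝 p) := by
    rw [ContinuousAt, hpy] at hcont
    exact hcont
  have hball : Metric.eball p (ENNReal.ofReal r) ∈ 𝓝 p :=
    Metric.eball_mem_nhds p (ENNReal.ofReal_pos.2 hr.1)
  have hseq : ∀ n : ℕ, ∃ y, dist (g y) G < 1 / ((n : ℝ) + 1) ∧
      dist y y₀ < 1 / ((n : ℝ) + 1) ∧ y ∉ N ∧ y ∈ (extChartAt (𝓡 m) p).target ∧
      (extChartAt (𝓡 m) p).symm y ∈ Metric.eball p (ENNReal.ofReal r) ∧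
      ∃ (τ : TangentSpace (𝓡 m) p →L[ℝ] TangentSpace (𝓡 m) ((extChartAt (𝓡 m) p).symm y))
        (T : EuclideanSpace ℝ (Fin m) →L[ℝ] EuclideanSpace ℝ (Fin m)),
        IsParallelTranslation p ((extChartAt (𝓡 m) p).symm y) τ ∧
          (∀ v, chartDiff p ((extChartAt (𝓡 m) p).symm y) (τ v) = T (chartDiff p p v)) ∧
          ‖T - 1‖ ≤ C * (edist p ((extChartAt (𝓡 m) p).symm y)).toReal := by
    intro n
    have hn : (0 : ℝ) < 1 / ((n : ℝ) + 1) := by positivity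
    have h1 := hG.frequently (Metric.ball_mem_nhds G hn)
    have h2 : ∀ᶠ y in 𝓝[Nᶜ] y₀, dist y y₀ < 1 / ((n : ℝ) + 1) :=
      nhdsWithin_le_nhds (Metric.ball_mem_nhds y₀ hn)
    have h3 : ∀ᶠ y in 𝓝[Nᶜ] y₀, y ∈ (extChartAt (𝓡 m) p).target :=
      nhdsWithin_le_nhds (extChartAt_target_mem_nhds p)
    have h4 : ∀ᶠ y in 𝓝[Nᶜ] y₀,
        (extChartAt (𝓡 m) p).symm y ∈ Metric.eball p (ENNReal.ofReal r) :=
      nhdsWithin_le_nhds (htend hball)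
    have h5 := nhdsWithin_le_nhds (s := Nᶜ) (htend.eventually hC)
    have h6 : ∀ᶠ y in 𝓝[Nᶜ] y₀, y ∉ N := self_mem_nhdsWithin
    obtain ⟨y, hy⟩ := (h1.and_eventually
      (h2.and (h6.and (h3.and (h4.and h5))))).exists
    exact ⟨y, hy⟩
  choose y hyG hyd hyN hyt hyr τ T hτ hτT hT using hseq
  have hlim0 : Tendsto (fun n : ℕ ↦ 1 / ((n : ℝ) + 1)) atTop (𝓝 0) :=
    tendsto_one_div_add_atTop_nhds_zero_nat
  have hy0 : Tendsto y atTop (𝓝 y₀) :=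
    tendsto_iff_dist_tendsto_zero.2 (squeeze_zero (fun _ ↦ dist_nonneg) (fun n ↦ (hyd n).le) hlim0)
  have hgG : Tendsto (fun n ↦ g (y n)) atTop (𝓝 G) :=
    tendsto_iff_dist_tendsto_zero.2 (squeeze_zero (fun _ ↦ dist_nonneg) (fun n ↦ (hyG n).le) hlim0)
  have hx : Tendsto (fun n ↦ (extChartAt (𝓡 m) p).symm (y n)) atTop (𝓝 p) := htend.comp hy0
  have hT1 : Tendsto T atTop (𝓝 1) := by
    rw [tendsto_iff_norm_sub_tendsto_zero]
    refine squeeze_zero (fun _ ↦ norm_nonneg _) hT ?_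
    have h1 : Tendsto (fun n ↦ edist p ((extChartAt (𝓡 m) p).symm (y n))) atTop (𝓝 0) := by
      simpa using (tendsto_const_nhds (x := p)).edist hx
    have h2 := (ENNReal.tendsto_toReal ENNReal.zero_ne_top).comp h1
    simpa using h2.const_mul C
  have hxA : ∀ n, (extChartAt (𝓡 m) p).symm (y n) ∉ A := fun n hn ↦
    hyN n ⟨_, ⟨hn, (extChartAt (𝓡 m) p).map_target (hyt n)⟩, (extChartAt (𝓡 m) p).right_inv (hyt n)⟩
  refine ⟨fun n ↦ (extChartAt (𝓡 m) p).symm (y n), τ, fun n ↦ ⟨hyr n, hxA n⟩, hτ, hx, ?_⟩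
  -- In the chart, translating and differentiating is `g (y n)` composed with `T n`; as `T n` tends
  -- to `1`, parallel translation disappears in the limit.
  have heq : ∀ n, (differential m F ((extChartAt (𝓡 m) p).symm (y n))).comp (τ n)
      = ((g (y n)).comp (T n)).comp (chartDiff p p) := by
    intro n
    ext v
    have h1 := differential_apply_eq_fderiv (hyt n) (hd _ ⟨hyr n, hxA n⟩) (τ n v)
    rw [hτT n v] at h1
    exact h1
  simp_rw [heq]
  have h7 : Tendsto (fun n ↦ (g (y n)).comp (T n)) atTop (𝓝 G) := by
    have h8 := (isBoundedBilinearMap_comp (𝕜 := ℝ) (E := EuclideanSpace ℝ (Fin m))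
      (F := EuclideanSpace ℝ (Fin m)) (G := ℝ)).continuous.tendsto (G, 1)
    exact h8.comp (hgG.prodMk_nhds hT1)
  exact ((ContinuousLinearMap.precomp ℝ (chartDiff p p)).continuous.tendsto G).comp h7

end Clarke

/-! ### Linear growth near a nonsingular point -/

section Increment

variable {m : ℕ} {M : Type*} [EMetricSpace M] [ChartedSpace (EuclideanSpace ℝ (Fin m)) M]
  [IsManifold (𝓡 m) ∞ M] [RiemannianBundle (fun x : M ↦ TangentSpace (𝓡 m) x)]
  [IsContMDiffRiemannianBundle (𝓡 m) ∞ (EuclideanSpace ℝ (Fin m))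
    (fun x : M ↦ TangentSpace (𝓡 m) x)] [IsRiemannianManifold (𝓡 m) M]

/-- If `0` is not in the convex hull of the limits of a bounded map `g` into the dual space, then
`g` is eventually bounded below on some vector. -/
theorem exists_eventually_le_apply {X E : Type*} [NormedAddCommGroup E] [InnerProductSpace ℝ E]
    [FiniteDimensional ℝ E] {l : Filter X} {g : X → E →L[ℝ] ℝ} {C : ℝ}
    (hC : ∀ᶠ x in l, ‖g x‖ ≤ C)
    (h0 : (0 : E →L[ℝ] ℝ) ∉ convexHull ℝ {G | MapClusterPt G l g}) :
    ∃ (v : E) (c : ℝ), 0 < c ∧ ∀ᶠ x in l, c ≤ g x v := by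
  have hK : IsCompact {G | MapClusterPt G l g} := by
    refine (isCompact_closedBall (0 : E →L[ℝ] ℝ) C).of_isClosed_subset isClosed_setOfPred_clusterPt
      fun G hG ↦ ?_
    refine isClosed_iff_clusterPt.1 Metric.isClosed_closedBall G (ClusterPt.mono hG ?_)
    rw [le_principal_iff, mem_map]
    filter_upwards [hC] with x hx
    simpa using hx
  obtain ⟨v, c, hc, hv⟩ := exists_forall_lt_apply_of_zero_notMem_convexHull hK h0
  refine ⟨v, c, hc, ?_⟩
  -- Otherwise the filter restricted to the violating points is nontrivial, and by compactness `g`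
  -- has a cluster point there with value at most `c` on `v`, although it is also a cluster point
  -- along `l`.
  by_contra hcon
  rw [Filter.not_eventually] at hcon
  simp only [not_le] at hcon
  have hne : (l ⊓ 𝓟 {x | g x v < c}).NeBot := frequently_mem_iff_neBot.1 hcon
  obtain ⟨G, -, hG⟩ := (isCompact_closedBall (0 : E →L[ℝ] ℝ) C).exists_mapClusterPt
    (f := l ⊓ 𝓟 {x | g x v < c}) (u := g) (by
      rw [le_principal_iff, mem_map]
      filter_upwards [mem_inf_of_left hC] with x hx
      simpa using hx)
  have h1 : c < G v := hv G (hG.mono inf_le_left)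
  have h2 : G ∈ {G : E →L[ℝ] ℝ | G v ≤ c} := by
    refine isClosed_iff_clusterPt.1 (isClosed_le (by fun_prop) continuous_const) G
      (ClusterPt.mono hG ?_)
    rw [le_principal_iff, mem_map]
    filter_upwards [mem_inf_of_right (mem_principal_self _)] with x hx
    exact le_of_lt hx
  exact absurd h1 (not_lt.2 h2)

/-- Near a nonsingular point a Lipschitz function grows linearly along some constant direction of
the chart. -/
theorem IsClarkeNonsingular.exists_increment (hm : 1 ≤ m) {F : M → ℝ} {L : ℝ≥0}
    (hF : LipschitzWith L F) {p : M} (hp : IsClarkeNonsingular m F p) :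
    ∃ (v : EuclideanSpace ℝ (Fin m)) (c R : ℝ) (L' : ℝ≥0), 0 < c ∧ 0 < R ∧
      Metric.ball (extChartAt (𝓡 m) p p) R ⊆ (extChartAt (𝓡 m) p).target ∧
      LipschitzOnWith L' (fun z ↦ F ((extChartAt (𝓡 m) p).symm z))
        (Metric.ball (extChartAt (𝓡 m) p p) R) ∧
      ∀ y s, 0 ≤ s → y ∈ Metric.ball (extChartAt (𝓡 m) p p) R →
        y + s • v ∈ Metric.ball (extChartAt (𝓡 m) p p) R →
        c * s ≤ F ((extChartAt (𝓡 m) p).symm (y + s • v)) - F ((extChartAt (𝓡 m) p).symm y) := by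
  obtain ⟨r, A, hr, hA, hd, hrank⟩ := hp
  obtain ⟨C, R₀, hR₀, hR₀t, hlip⟩ := exists_edist_extChartAt_symm_le (m := m) p
  set y₀ := extChartAt (𝓡 m) p p with hy₀
  set f : EuclideanSpace ℝ (Fin m) → ℝ := fun z ↦ F ((extChartAt (𝓡 m) p).symm z) with hf
  have hflip : LipschitzOnWith (L * C) f (Metric.ball y₀ R₀) := hF.comp_lipschitzOnWith hlip
  -- Limits must avoid `N`: where `f` is not differentiable, `fderiv` has the default value `0`,
  -- which could put `0` into the hull.
  set N := extChartAt (𝓡 m) p '' (A ∩ (extChartAt (𝓡 m) p).source) with hN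
  have hbd : ∀ᶠ y in 𝓝[Nᶜ] y₀, ‖fderiv ℝ f y‖ ≤ (L * C : ℝ≥0) := by
    refine nhdsWithin_le_nhds ?_
    filter_upwards [Metric.ball_mem_nhds y₀ hR₀] with y hy
    exact norm_fderiv_le_of_lipschitzOn ℝ (Metric.isOpen_ball.mem_nhds hy) hflip
  have h0 : (0 : EuclideanSpace ℝ (Fin m) →L[ℝ] ℝ) ∉
      convexHull ℝ {G | MapClusterPt G (𝓝[Nᶜ] y₀) (fderiv ℝ f)} := by
    intro h0
    -- Precomposition with the differential of the chart is linear, so it commutes with convex hulls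
    -- and would carry `0` into the generalized differential, against rank one.
    let J : (EuclideanSpace ℝ (Fin m) →L[ℝ] ℝ) →ₗ[ℝ] (TangentSpace (𝓡 m) p →L[ℝ] ℝ) :=
      (ContinuousLinearMap.precomp ℝ (chartDiff p p)).toLinearMap
    have h1 := mem_image_of_mem J h0
    rw [J.image_convexHull, map_zero] at h1
    have h2 : (0 : TangentSpace (𝓡 m) p →L[ℝ] ℝ) ∈ generalizedDifferential m F p r A := by
      refine convexHull_mono ?_ h1
      rintro _ ⟨G, hG, rfl⟩
      exact comp_chartDiff_mem_mixture hr hd hG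
    have h3 := hrank 0 h2
    have h4 : LinearMap.range (0 : TangentSpace (𝓡 m) p →L[ℝ] ℝ).toLinearMap = ⊥ :=
      LinearMap.range_zero
    rw [min_eq_right hm, h4, finrank_bot] at h3
    exact zero_ne_one h3
  obtain ⟨v, c, hc, hv⟩ := exists_eventually_le_apply hbd h0
  have hball : ∀ᶠ y in 𝓝 y₀,
      (extChartAt (𝓡 m) p).symm y ∈ Metric.eball p (ENNReal.ofReal r) := by
    have hcont : ContinuousAt (extChartAt (𝓡 m) p).symm y₀ := continuousAt_extChartAt_symm p
    refine hcont.eventually_mem ?_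
    rw [hy₀, extChartAt_to_inv p]
    exact Metric.eball_mem_nhds p (ENNReal.ofReal_pos.2 hr.1)
  rw [eventually_nhdsWithin_iff] at hv
  obtain ⟨R₁, hR₁, hR₁s⟩ := Metric.mem_nhds_iff.1 (hball.and hv)
  have hsub : Metric.ball y₀ (min R₀ R₁) ⊆ Metric.ball y₀ R₀ :=
    Metric.ball_subset_ball (min_le_left _ _)
  have hsub' : Metric.ball y₀ (min R₀ R₁) ⊆ Metric.ball y₀ R₁ :=
    Metric.ball_subset_ball (min_le_right _ _)
  refine ⟨v, c, min R₀ R₁, L * C, hc, lt_min hR₀ hR₁, hsub.trans hR₀t, hflip.mono hsub,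
    fun y s hs hy hys ↦ ?_⟩
  refine mul_le_sub_of_ae_le_fderiv volume (hflip.mono hsub) ?_ hs hy hys
  have hae : ∀ᵐ y : EuclideanSpace ℝ (Fin m), y ∉ N := measure_eq_zero_iff_ae_notMem.1 (hA p)
  filter_upwards [hae] with z hz hzb
  obtain ⟨h1, h2⟩ := hR₁s (hsub' hzb)
  have hzt := hR₀t (hsub hzb)
  refine ⟨(hasFDerivAt_comp_extChartAt_symm hzt (hd _ ⟨h1, fun hzA ↦ hz ?_⟩)).differentiableAt,
    h2 hz⟩
  exact ⟨_, ⟨hzA, (extChartAt (𝓡 m) p).map_target hzt⟩, (extChartAt (𝓡 m) p).right_inv hzt⟩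

end Increment

/-! ### Change of coordinates, mollification and gluing -/

section LocalEstimate

variable {E₀ : Type*} [NormedAddCommGroup E₀] [NormedSpace ℝ E₀]
  {E : Type*} [NormedAddCommGroup E] [NormedSpace ℝ E]

/-- Linear growth in a constant direction is transported by a local diffeomorphism, with a smaller
constant and uniformly in nearby directions. -/
theorem exists_increment_comp {f : E₀ → ℝ} {Y v : E₀} {R c : ℝ} {L : ℝ≥0} (hc : 0 < c)
    (hlip : LipschitzOnWith L f (Metric.ball Y R))
    (hinc : ∀ y s, 0 ≤ s → y ∈ Metric.ball Y R → y + s • v ∈ Metric.ball Y R →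
      c * s ≤ f (y + s • v) - f y)
    {κ : E → E₀} {κ' : E →L[ℝ] E₀} {z₁ w₁ : E} (hκ : HasStrictFDerivAt κ κ' z₁)
    (hz₁ : κ z₁ ∈ Metric.ball Y R) (hw₁ : κ' w₁ = v) :
    ∃ δ > 0, ∀ z ∈ Metric.ball z₁ δ, ∀ w ∈ Metric.ball w₁ δ, ∀ s ∈ Ioo 0 δ,
      c / 2 * s ≤ f (κ (z + s • w)) - f (κ z) := by
  -- Chosen so that the displacement error below, multiplied by the Lipschitz constant, costs at
  -- most `c / 2 * s`.
  set η := c / (2 * (L + 1) * (‖w₁‖ + 1 + ‖κ'‖ + 1)) with hη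
  have hη0 : 0 < η := by positivity
  have hηc : L * (η * (‖w₁‖ + 1) + ‖κ'‖ * η) ≤ c / 2 := by
    have h1 : η * (2 * (L + 1) * (‖w₁‖ + 1 + ‖κ'‖ + 1)) = c := by
      rw [hη]
      field_simp
    have h2 : (0 : ℝ) ≤ L := L.2
    nlinarith [mul_nonneg hη0.le h2, mul_nonneg hη0.le (norm_nonneg κ'),
      mul_nonneg hη0.le (norm_nonneg w₁)]
  have hstrict := hκ.isLittleO.def hη0
  rw [nhds_prod_eq, Metric.nhds_basis_ball.prod_self.eventually_iff] at hstrict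
  obtain ⟨δ₁, hδ₁, hstrict⟩ := hstrict
  obtain ⟨R₁, hR₁, hR₁s⟩ := Metric.mem_nhds_iff.1 (Metric.isOpen_ball.mem_nhds hz₁)
  have hnear : ∀ᶠ z in 𝓝 z₁, κ z ∈ Metric.ball (κ z₁) (R₁ / 2) :=
    hκ.continuousAt.eventually_mem (Metric.ball_mem_nhds _ (by positivity))
  obtain ⟨δ₂, hδ₂, hnear⟩ := Metric.mem_nhds_iff.1 hnear
  set d := min δ₁ δ₂ with hd
  have hd0 : 0 < d := lt_min hδ₁ hδ₂
  set δ := min (min 1 η) (min (min (d / 2) (d / (2 * (‖w₁‖ + 1)))) (R₁ / (2 * (‖v‖ + 1))))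
    with hδ
  have hδ0 : 0 < δ := by positivity
  have hδ1 : δ ≤ 1 := (min_le_left _ _).trans (min_le_left _ _)
  have hδη : δ ≤ η := (min_le_left _ _).trans (min_le_right _ _)
  have hδd : δ ≤ d / 2 := (min_le_right _ _).trans ((min_le_left _ _).trans (min_le_left _ _))
  have hδw : δ ≤ d / (2 * (‖w₁‖ + 1)) :=
    (min_le_right _ _).trans ((min_le_left _ _).trans (min_le_right _ _))
  have hδv : δ ≤ R₁ / (2 * (‖v‖ + 1)) := (min_le_right _ _).trans (min_le_right _ _)
  refine ⟨δ, hδ0, fun z hz w hw s hs ↦ ?_⟩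
  rw [mem_ball_iff_norm] at hz hw
  have hwn : ‖w‖ ≤ ‖w₁‖ + 1 := by linarith [norm_le_norm_sub_add w w₁]
  have hsw : ‖s • w‖ < d / 2 := by
    rw [norm_smul, Real.norm_of_nonneg hs.1.le]
    calc s * ‖w‖ ≤ s * (‖w₁‖ + 1) := by gcongr; exact hs.1.le
      _ < δ * (‖w₁‖ + 1) := by gcongr; exact hs.2
      _ ≤ d / (2 * (‖w₁‖ + 1)) * (‖w₁‖ + 1) := by gcongr
      _ = d / 2 := by field_simp
  have hzd : z ∈ Metric.ball z₁ d := by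
    rw [mem_ball_iff_norm]
    linarith
  have hzsd : z + s • w ∈ Metric.ball z₁ d := by
    rw [mem_ball_iff_norm]
    calc ‖z + s • w - z₁‖ = ‖(z - z₁) + s • w‖ := by congr 1; abel
      _ ≤ ‖z - z₁‖ + ‖s • w‖ := norm_add_le _ _
      _ < d := by linarith
  have hκz := hnear (Metric.ball_subset_ball (min_le_right _ _) hzd)
  have hκzs := hnear (Metric.ball_subset_ball (min_le_right _ _) hzsd)
  have hκv : κ z + s • v ∈ Metric.ball Y R := by
    refine hR₁s ?_
    rw [mem_ofPred_eq, mem_ball_iff_norm] at hκz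
    rw [mem_ball_iff_norm]
    have : ‖s • v‖ < R₁ / 2 := by
      rw [norm_smul, Real.norm_of_nonneg hs.1.le]
      calc s * ‖v‖ ≤ s * (‖v‖ + 1) := by
            have := hs.1.le
            gcongr
            linarith
        _ < δ * (‖v‖ + 1) := by gcongr; exact hs.2
        _ ≤ R₁ / (2 * (‖v‖ + 1)) * (‖v‖ + 1) := by gcongr
        _ = R₁ / 2 := by field_simp
    calc ‖κ z + s • v - κ z₁‖ = ‖(κ z - κ z₁) + s • v‖ := by congr 1; abel
      _ ≤ ‖κ z - κ z₁‖ + ‖s • v‖ := norm_add_le _ _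
      _ < R₁ := by linarith
  have hhalf : Metric.ball (κ z₁) (R₁ / 2) ⊆ Metric.ball Y R :=
    (Metric.ball_subset_ball (by linarith)).trans hR₁s
  have hmain := hinc (κ z) s hs.1.le (hhalf hκz) hκv
  -- Two errors: strict differentiability of `κ`, uniform in the base point, and the deviation of
  -- the direction `w` from `w₁`.
  have herr : ‖κ (z + s • w) - (κ z + s • v)‖ ≤ s * (η * (‖w₁‖ + 1) + ‖κ'‖ * η) := by
    have h1 := hstrict (x := (z + s • w, z)) ⟨Metric.ball_subset_ball (min_le_left _ _) hzsd,
      Metric.ball_subset_ball (min_le_left _ _) hzd⟩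
    simp only [add_sub_cancel_left] at h1
    have h2 : κ (z + s • w) - (κ z + s • v)
        = (κ (z + s • w) - κ z - κ' (s • w)) + s • κ' (w - w₁) := by
      rw [map_smul, map_sub, hw₁, smul_sub]
      abel
    rw [h2]
    refine (norm_add_le _ _).trans ?_
    have h3 : ‖s • κ' (w - w₁)‖ ≤ s * (‖κ'‖ * η) := by
      rw [norm_smul, Real.norm_of_nonneg hs.1.le]
      have := hs.1.le
      gcongr
      refine (κ'.le_opNorm _).trans ?_
      gcongr
      linarith
    have h4 : η * ‖s • w‖ ≤ s * (η * (‖w₁‖ + 1)) := by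
      rw [norm_smul, Real.norm_of_nonneg hs.1.le]
      have := mul_le_mul_of_nonneg_left hwn (mul_nonneg hη0.le hs.1.le)
      linarith
    linarith
  have hl := hlip.dist_le_mul _ (hhalf hκzs) _ hκv
  rw [Real.dist_eq, dist_eq_norm] at hl
  have hl2 := (abs_le.1 hl).1
  have hl3 : L * ‖κ (z + s • w) - (κ z + s • v)‖ ≤ c / 2 * s := by
    calc L * ‖κ (z + s • w) - (κ z + s • v)‖
        ≤ L * (s * (η * (‖w₁‖ + 1) + ‖κ'‖ * η)) := by gcongr
      _ = s * (L * (η * (‖w₁‖ + 1) + ‖κ'‖ * η)) := by ring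
      _ ≤ s * (c / 2) := by have := hs.1.le; gcongr
      _ = c / 2 * s := by ring
  linarith

variable [FiniteDimensional ℝ E] [MeasurableSpace E] [BorelSpace E] {μ : Measure E}
  [μ.IsAddHaarMeasure]

/-- Mollifying, in other coordinates, a Lipschitz function that grows linearly in the direction `v`
gives smooth approximations with positive derivative in the direction `v`. -/
theorem eventually_mollification {f : E₀ → ℝ} {Y v : E₀} {R c : ℝ} {L : ℝ≥0} (hc : 0 < c)
    (hlip : LipschitzOnWith L f (Metric.ball Y R))
    (hinc : ∀ y s, 0 ≤ s → y ∈ Metric.ball Y R → y + s • v ∈ Metric.ball Y R →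
      c * s ≤ f (y + s • v) - f y)
    {κ : E → E₀} {θ : E₀ → E} {y₁ : E₀} (hy₁ : y₁ ∈ Metric.ball Y R) (hθ : ContDiffAt ℝ 1 θ y₁)
    (hκ : ContDiffAt ℝ 1 κ (θ y₁)) (hκθ : ∀ᶠ y in 𝓝 y₁, κ (θ y) = y)
    {h : E → ℝ} (hh : ∀ᶠ z in 𝓝 (θ y₁), h z = f (κ z)) {ρ : ℝ → E → ℝ}
    (hρ : ∀ ε > 0, ContDiff ℝ 1 (ρ ε)) (hρ0 : ∀ ε > 0, ∀ u, ε ≤ ‖u‖ → ρ ε u = 0)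
    (hpos : ∀ ε > 0, ∀ u, 0 ≤ ρ ε u) (hint : ∀ ε > 0, ∫ u, ρ ε u ∂μ = 1) {η : ℝ} (hη : 0 < η) :
    ∀ᶠ x : ℝ × E₀ in 𝓝[>] 0 ×ˢ 𝓝 y₁,
      DifferentiableAt ℝ (fun y ↦ ∫ u, ρ x.1 u * h (θ y - u) ∂μ) x.2 ∧
      c / 2 ≤ fderiv ℝ (fun y ↦ ∫ u, ρ x.1 u * h (θ y - u) ∂μ) x.2 v ∧
      |(∫ u, ρ x.1 u * h (θ x.2 - u) ∂μ) - f x.2| ≤ η := by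
  set z₁ := θ y₁ with hz₁
  have hκz₁ : κ z₁ = y₁ := hκθ.self_of_nhds
  have hθd : HasFDerivAt θ (fderiv ℝ θ y₁) y₁ := (hθ.differentiableAt (by simp)).hasFDerivAt
  have hκd : HasStrictFDerivAt κ (fderiv ℝ κ z₁) z₁ := hκ.hasStrictFDerivAt (by simp)
  set w₁ := fderiv ℝ θ y₁ v with hw₁
  have hw₁v : fderiv ℝ κ z₁ w₁ = v := by
    have h1 : HasFDerivAt (fun y ↦ κ (θ y)) ((fderiv ℝ κ z₁).comp (fderiv ℝ θ y₁)) y₁ :=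
      hκd.hasFDerivAt.comp y₁ hθd
    have h2 : HasFDerivAt (fun y ↦ κ (θ y)) (ContinuousLinearMap.id ℝ E₀) y₁ :=
      (hasFDerivAt_id y₁).congr_of_eventuallyEq hκθ
    exact congr($(h1.unique h2) v)
  obtain ⟨δ₀, hδ₀, hδ₀inc⟩ := exists_increment_comp hc hlip hinc hκd (by rwa [hκz₁]) hw₁v
  have hfc : ContinuousOn f (Metric.ball Y R) := hlip.continuousOn
  have hκnear : ∀ᶠ z in 𝓝 z₁, κ z ∈ Metric.ball Y R :=
    hκ.continuousAt.eventually_mem (Metric.isOpen_ball.mem_nhds (by rwa [hκz₁]))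
  have hκcont : ∀ᶠ z in 𝓝 z₁, ContinuousAt κ z :=
    (hκ.eventually (by simp)).mono fun z hz ↦ hz.continuousAt
  have hclose : ∀ᶠ z in 𝓝 z₁, |f (κ z) - f y₁| < η / 2 := by
    have h1 : ContinuousAt (fun z ↦ |f (κ z) - f y₁|) z₁ := by
      have h2 : ContinuousAt f (κ z₁) := by
        rw [hκz₁]
        exact hfc.continuousAt (Metric.isOpen_ball.mem_nhds hy₁)
      have h3 : ContinuousAt (fun z ↦ f (κ z)) z₁ := ContinuousAt.comp h2 hκ.continuousAt
      exact (h3.sub continuousAt_const).abs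
    refine h1.eventually_lt continuousAt_const ?_
    simp [hκz₁, hη]
  obtain ⟨δ₁, hδ₁, hball⟩ := Metric.mem_nhds_iff.1 (hh.and (hκnear.and (hκcont.and hclose)))
  have hhc : ContinuousOn h (Metric.ball z₁ δ₁) := by
    have : ContinuousOn (fun z ↦ f (κ z)) (Metric.ball z₁ δ₁) :=
      hfc.comp (fun z hz ↦ (hball hz).2.2.1.continuousWithinAt) fun z hz ↦ (hball hz).2.1
    exact this.congr fun z hz ↦ (hball hz).1
  set d := min δ₀ δ₁ with hd
  have hd0 : 0 < d := lt_min hδ₀ hδ₁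
  have hε : ∀ᶠ ε : ℝ in 𝓝[>] 0, ε ∈ Ioo 0 (d / 4) :=
    Ioo_mem_nhdsGT (by positivity)
  have hy : ∀ᶠ y in 𝓝 y₁, θ y ∈ Metric.ball z₁ (d / 4) ∧ DifferentiableAt ℝ θ y ∧
      fderiv ℝ θ y v ∈ Metric.ball w₁ δ₀ ∧ |f y - f y₁| < η / 2 := by
    refine (hθ.continuousAt.eventually_mem (Metric.ball_mem_nhds _ (by positivity))).and
      (((hθ.eventually (by simp)).mono fun y hy ↦ hy.differentiableAt (by simp)).and
        (Filter.Eventually.and ?_ ?_))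
    · have h1 : ContinuousAt (fun y ↦ fderiv ℝ θ y v) y₁ :=
        (hθ.continuousAt_fderiv (by simp)).clm_apply continuousAt_const
      exact h1.eventually_mem (Metric.ball_mem_nhds _ hδ₀)
    · have h1 : ContinuousAt (fun y ↦ |f y - f y₁|) y₁ :=
        ((hfc.continuousAt (Metric.isOpen_ball.mem_nhds hy₁)).sub continuousAt_const).abs
      refine h1.eventually_lt continuousAt_const ?_
      simp [hη]
  filter_upwards [hε.prod_mk hy] with ⟨ε, y⟩ ⟨hε, hθy, hθdy, hwy, hfy⟩
  simp only at hε hθy hθdy hwy hfy ⊢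
  have hε0 : 0 < ε := hε.1
  have hdist : dist (θ y) z₁ + ε < δ₁ := by
    have := hε.2
    have h2 : d ≤ δ₁ := min_le_right _ _
    rw [Metric.mem_ball] at hθy
    linarith
  have hsub : ∀ u, ‖u‖ < ε → θ y - u ∈ Metric.ball z₁ (d / 2) := by
    intro u hu
    rw [mem_ball_iff_norm] at hθy ⊢
    calc ‖θ y - u - z₁‖ = ‖(θ y - z₁) - u‖ := by congr 1; abel
      _ ≤ ‖θ y - z₁‖ + ‖u‖ := norm_sub_le _ _
      _ < d / 2 := by linarith [hε.2]
  set Φ : E → ℝ := fun z ↦ ∫ u, ρ ε u * h (z - u) ∂μ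
  have hΦd : DifferentiableAt ℝ Φ (θ y) :=
    differentiableAt_integral_mul_comp_sub (hρ ε hε0) (hρ0 ε hε0) hhc hdist
  have hcomp : HasFDerivAt (fun y ↦ ∫ u, ρ ε u * h (θ y - u) ∂μ)
      ((fderiv ℝ Φ (θ y)).comp (fderiv ℝ θ y)) y := hΦd.hasFDerivAt.comp y hθdy.hasFDerivAt
  refine ⟨hcomp.differentiableAt, ?_, ?_⟩
  · rw [hcomp.fderiv, ContinuousLinearMap.comp_apply]
    refine le_fderiv_integral_mul_comp_sub (hρ ε hε0) (hρ0 ε hε0) (hpos ε hε0) (hint ε hε0) hhc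
      hdist ?_
    have hs1 : ∀ᶠ s : ℝ in 𝓝[>] 0, s ∈ Ioo 0 δ₀ := Ioo_mem_nhdsGT hδ₀
    have hs2 : ∀ᶠ s : ℝ in 𝓝[>] 0, ‖s • fderiv ℝ θ y v‖ < d / 2 := by
      refine nhdsWithin_le_nhds ?_
      have h1 : ContinuousAt (fun s : ℝ ↦ ‖s • fderiv ℝ θ y v‖) 0 := by fun_prop
      exact h1.eventually_lt continuousAt_const (by simpa using hd0)
    -- The direction here is the derivative of `θ` at `y`, not at `y₁`; this is why the growth
    -- estimate was made uniform in nearby directions.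
    filter_upwards [hs1, hs2] with s hs1 hs2 u hu
    have hz := hsub u hu
    have hzd : θ y - u ∈ Metric.ball z₁ d := Metric.ball_subset_ball (by linarith) hz
    have hzs : θ y - u + s • fderiv ℝ θ y v ∈ Metric.ball z₁ d := by
      rw [mem_ball_iff_norm] at hz ⊢
      calc ‖θ y - u + s • fderiv ℝ θ y v - z₁‖
          = ‖(θ y - u - z₁) + s • fderiv ℝ θ y v‖ := by congr 1; abel
        _ ≤ ‖θ y - u - z₁‖ + ‖s • fderiv ℝ θ y v‖ := norm_add_le _ _
        _ < d := by linarith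
    rw [(hball (Metric.ball_subset_ball (min_le_right _ _) hzd)).1,
      (hball (Metric.ball_subset_ball (min_le_right _ _) hzs)).1]
    exact hδ₀inc _ (Metric.ball_subset_ball (min_le_left _ _) hzd) _ hwy s hs1
  · refine abs_integral_mul_comp_sub_sub_le (hρ ε hε0).continuous (hρ0 ε hε0) (hpos ε hε0)
      (hint ε hε0) hhc hdist fun u hu ↦ ?_
    have hzd : θ y - u ∈ Metric.ball z₁ d := Metric.ball_subset_ball (by linarith) (hsub u hu)
    obtain ⟨h1, -, -, h2⟩ := hball (Metric.ball_subset_ball (min_le_right _ _) hzd)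
    rw [h1]
    have h3 := abs_sub_le (f (κ (θ y - u))) (f y₁) (f y)
    rw [abs_sub_comm (f y₁)] at h3
    linarith

/-- Gluing local approximations by a partition of unity keeps the derivative in the direction `v`
positive. -/
theorem eventually_pos_fderiv_sum {ι : Type*} (I : Finset ι) {ψ : ι → E₀ → ℝ} {f : E₀ → ℝ}
    {g : ι → ℝ → E₀ → ℝ} {y₁ v : E₀} {c : ℝ} (hc : 0 < c)
    (hψ : ∀ i ∈ I, ContDiffAt ℝ 1 (ψ i) y₁) (hψ0 : ∀ i ∈ I, ∀ y, 0 ≤ ψ i y)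
    (hψ1 : ∀ᶠ y in 𝓝 y₁, ∑ i ∈ I, ψ i y = 1)
    (hg : ∀ i ∈ I, ∀ η > 0, ∀ᶠ x : ℝ × E₀ in 𝓝[>] 0 ×ˢ 𝓝 y₁,
      DifferentiableAt ℝ (g i x.1) x.2 ∧ c ≤ fderiv ℝ (g i x.1) x.2 v ∧
        |g i x.1 x.2 - f x.2| ≤ η) :
    ∀ᶠ x : ℝ × E₀ in 𝓝[>] 0 ×ˢ 𝓝 y₁,
      DifferentiableAt ℝ (fun y ↦ ∑ i ∈ I, ψ i y * g i x.1 y) x.2 ∧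
        0 < fderiv ℝ (fun y ↦ ∑ i ∈ I, ψ i y * g i x.1 y) x.2 v := by
  set B : ℝ := ∑ i ∈ I, (|fderiv ℝ (ψ i) y₁ v| + 1) with hB
  have hB0 : 0 ≤ B := Finset.sum_nonneg fun i _ ↦ by positivity
  -- With this closeness to `f` the terms containing derivatives of the `ψ i` total at most `c / 2`;
  -- the `+ 1` covers an empty index set.
  have hη : 0 < c / (2 * (B + 1)) := by positivity
  have hψd : ∀ᶠ y in 𝓝 y₁, ∀ i ∈ I, DifferentiableAt ℝ (ψ i) y ∧
      |fderiv ℝ (ψ i) y v| < |fderiv ℝ (ψ i) y₁ v| + 1 := by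
    rw [Filter.eventually_all_finset]
    intro i hi
    have h1 : ContinuousAt (fun y ↦ |fderiv ℝ (ψ i) y v|) y₁ :=
      (((hψ i hi).continuousAt_fderiv (by simp)).clm_apply continuousAt_const).abs
    exact (((hψ i hi).eventually (by simp)).mono fun y hy ↦ hy.differentiableAt (by simp)).and
      (h1.eventually_lt continuousAt_const (lt_add_one _))
  have hg' : ∀ᶠ x : ℝ × E₀ in 𝓝[>] 0 ×ˢ 𝓝 y₁, ∀ i ∈ I, DifferentiableAt ℝ (g i x.1) x.2 ∧
      c ≤ fderiv ℝ (g i x.1) x.2 v ∧ |g i x.1 x.2 - f x.2| ≤ c / (2 * (B + 1)) := by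
    rw [Filter.eventually_all_finset]
    exact fun i hi ↦ hg i hi _ hη
  have hψ2 : ∀ᶠ y in 𝓝 y₁, ∑ i ∈ I, ψ i y = 1 ∧ ∑ i ∈ I, fderiv ℝ (ψ i) y v = 0 := by
    filter_upwards [hψ1, hψ1.eventually_nhds, hψd] with y h1 h2 h3
    refine ⟨h1, ?_⟩
    have h4 : HasFDerivAt (fun y ↦ ∑ i ∈ I, ψ i y) (∑ i ∈ I, fderiv ℝ (ψ i) y) y :=
      HasFDerivAt.fun_sum fun i hi ↦ (h3 i hi).1.hasFDerivAt
    have h5 : HasFDerivAt (fun y ↦ ∑ i ∈ I, ψ i y) (0 : E₀ →L[ℝ] ℝ) y :=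
      (hasFDerivAt_const (1 : ℝ) y).congr_of_eventuallyEq h2
    have h6 := congr($(h4.unique h5) v)
    simpa using h6
  filter_upwards [hg', (hψd.and hψ2).prod_inr (𝓝[>] 0)] with ⟨ε, y⟩ hgx ⟨hψx, hψs, hψs'⟩
  simp only at hgx hψx hψs hψs' ⊢
  have hder : HasFDerivAt (fun y ↦ ∑ i ∈ I, ψ i y * g i ε y)
      (∑ i ∈ I, (ψ i y • fderiv ℝ (g i ε) y + g i ε y • fderiv ℝ (ψ i) y)) y :=
    HasFDerivAt.fun_sum fun i hi ↦ (hψx i hi).1.hasFDerivAt.mul (hgx i hi).1.hasFDerivAt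
  refine ⟨hder.differentiableAt, ?_⟩
  rw [hder.fderiv]
  -- Subtracting `f y` is free, because the derivatives of the `ψ i` sum to zero.
  have h1 : (∑ i ∈ I, (ψ i y • fderiv ℝ (g i ε) y + g i ε y • fderiv ℝ (ψ i) y)) v
      = ∑ i ∈ I, ψ i y * fderiv ℝ (g i ε) y v
        + ∑ i ∈ I, (g i ε y - f y) * fderiv ℝ (ψ i) y v := by
    simp only [sub_mul, Finset.sum_sub_distrib, ← Finset.mul_sum, hψs']
    simp [Finset.sum_add_distrib]
  have h2 : c ≤ ∑ i ∈ I, ψ i y * fderiv ℝ (g i ε) y v := by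
    calc c = ∑ i ∈ I, ψ i y * c := by rw [← Finset.sum_mul, hψs, one_mul]
      _ ≤ _ := Finset.sum_le_sum fun i hi ↦
        mul_le_mul_of_nonneg_left (hgx i hi).2.1 (hψ0 i hi y)
  have h3 : |∑ i ∈ I, (g i ε y - f y) * fderiv ℝ (ψ i) y v| ≤ c / (2 * (B + 1)) * B := by
    refine (Finset.abs_sum_le_sum_abs _ _).trans ?_
    rw [hB, Finset.mul_sum]
    refine Finset.sum_le_sum fun i hi ↦ ?_
    rw [abs_mul]
    exact mul_le_mul (hgx i hi).2.2 (hψx i hi).2.le (abs_nonneg _) hη.le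
  have h4 : c / (2 * (B + 1)) * B ≤ c / 2 := by
    rw [div_mul_eq_mul_div, div_le_div_iff₀ (by positivity) (by positivity)]
    nlinarith
  rw [h1]
  linarith [(abs_le.1 h3).1]

end LocalEstimate

/-! ### The explicit mollifier on a tangent space -/

section Mollifier

variable {m : ℕ} {M : Type*} [EMetricSpace M] [ChartedSpace (EuclideanSpace ℝ (Fin m)) M]
  [RiemannianBundle (fun x : M ↦ TangentSpace (𝓡 m) x)]

/-- Smoothness across the unit sphere is inherited from the standard flat function `expNegInvGlue`.
-/
theorem bump_eq {x : M} (y : TangentSpace (𝓡 m) x) : bump y = expNegInvGlue (1 - ‖y‖ ^ 2) := by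
  rw [bump, expNegInvGlue]
  by_cases hy : ‖y‖ < 1
  · have h1 : ¬ 1 - ‖y‖ ^ 2 ≤ 0 := by nlinarith [norm_nonneg y]
    rw [if_pos hy, if_neg h1, neg_div, one_div]
  · have h1 : 1 - ‖y‖ ^ 2 ≤ 0 := by nlinarith [norm_nonneg y]
    rw [if_neg hy, if_pos h1]

theorem contDiff_bump (x : M) : ContDiff ℝ 1 (bump : TangentSpace (𝓡 m) x → ℝ) := by
  have h : (bump : TangentSpace (𝓡 m) x → ℝ) = fun y ↦ expNegInvGlue (1 - ‖y‖ ^ 2) :=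
    funext bump_eq
  rw [h]
  exact expNegInvGlue.contDiff.comp (contDiff_const.sub (contDiff_norm_sq ℝ))

theorem bump_nonneg {x : M} (y : TangentSpace (𝓡 m) x) : 0 ≤ bump y := by
  rw [bump_eq]
  exact expNegInvGlue.nonneg _

theorem bump_eq_zero {x : M} {y : TangentSpace (𝓡 m) x} (hy : 1 ≤ ‖y‖) : bump y = 0 :=
  if_neg (not_lt.2 hy)

theorem integral_bump_pos (x : M) : 0 < ∫ z : TangentSpace (𝓡 m) x, bump z := by
  refine (contDiff_bump x).continuous.integral_pos_of_hasCompactSupport_nonneg_nonzero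
    (x := 0) ?_ bump_nonneg ?_
  · have : ProperSpace (TangentSpace (𝓡 m) x) := FiniteDimensional.proper ℝ _
    refine HasCompactSupport.of_support_subset_isCompact (isCompact_closedBall 0 1) fun y hy ↦ ?_
    by_contra hy'
    rw [mem_closedBall_zero_iff, not_le] at hy'
    exact hy (bump_eq_zero hy'.le)
  · rw [bump_eq]
    exact (expNegInvGlue.pos_of_pos (by simp)).ne'

theorem contDiff_mollifier (x : M) (ε : ℝ) :
    ContDiff ℝ 1 (mollifier x ε : TangentSpace (𝓡 m) x → ℝ) :=
  (contDiff_const.mul ((contDiff_bump x).comp (contDiff_const_smul ε⁻¹))).div_const _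

theorem mollifier_nonneg (x : M) {ε : ℝ} (hε : 0 < ε) (y : TangentSpace (𝓡 m) x) :
    0 ≤ mollifier x ε y :=
  div_nonneg (mul_nonneg (inv_nonneg.2 (integral_bump_pos x).le) (bump_nonneg _))
    (pow_nonneg hε.le m)

theorem mollifier_eq_zero (x : M) {ε : ℝ} (hε : 0 < ε) {y : TangentSpace (𝓡 m) x}
    (hy : ε ≤ ‖y‖) : mollifier x ε y = 0 := by
  have h : 1 ≤ ‖ε⁻¹ • y‖ := by
    rw [norm_smul, norm_inv, Real.norm_of_nonneg hε.le, inv_mul_eq_div, le_div_iff₀ hε]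
    linarith
  rw [mollifier, bump_eq_zero h]
  simp

theorem integral_mollifier (x : M) {ε : ℝ} (hε : 0 < ε) :
    ∫ y : TangentSpace (𝓡 m) x, mollifier x ε y = 1 := by
  have hdim : Module.finrank ℝ (TangentSpace (𝓡 m) x) = m :=
    finrank_euclideanSpace_fin (𝕜 := ℝ) (n := m)
  simp only [mollifier]
  rw [integral_div, integral_const_mul, Measure.integral_comp_inv_smul, hdim,
    abs_of_pos (pow_pos hε m), smul_eq_mul]
  have h1 := (integral_bump_pos (m := m) x).ne'
  have h2 := (pow_pos hε m).ne'
  field_simp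

end Mollifier

/-! ### Local and global approximations on the manifold -/

section GlobalApproximation

variable {m : ℕ} {M : Type*} [EMetricSpace M] [ChartedSpace (EuclideanSpace ℝ (Fin m)) M]
  [RiemannianBundle (fun x : M ↦ TangentSpace (𝓡 m) x)]

theorem IsConvexRadius.expInv_mem {a : M} {r : ℝ} (ha : IsConvexRadius m a r) {q : M}
    (hq : q ∈ Metric.eball a (ENNReal.ofReal r)) : expInv m a r q ∈ Metric.ball 0 r :=
  Function.invFunOn_mem (ha.2.2.2.2.1.surjOn hq)

theorem IsConvexRadius.expMap_expInv {a : M} {r : ℝ} (ha : IsConvexRadius m a r) {q : M}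
    (hq : q ∈ Metric.eball a (ENNReal.ofReal r)) : expMap a (expInv m a r q) = q :=
  Function.invFunOn_eq (ha.2.2.2.2.1.surjOn hq)

/-- The inverse obtained by choice agrees on the ball with the smooth left inverse supplied by the
diffeomorphism condition. -/
theorem IsConvexRadius.contMDiffOn_expInv {a : M} {r : ℝ} (ha : IsConvexRadius m a r) :
    ContMDiffOn (𝓡 m) 𝓘(ℝ, TangentSpace (𝓡 m) a) ∞ (expInv m a r)
      (Metric.eball a (ENNReal.ofReal r)) := by
  obtain ⟨g, hg, hleft⟩ := ha.2.2.2.2.2.2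
  refine hg.congr fun q hq ↦ ?_
  conv_rhs => rw [← ha.expMap_expInv hq]
  exact (hleft (ha.expInv_mem hq)).symm

theorem IsConvexRadius.contMDiffOn_expMap {a : M} {r : ℝ} (ha : IsConvexRadius m a r) :
    ContMDiffOn 𝓘(ℝ, TangentSpace (𝓡 m) a) (𝓡 m) ∞ (expMap a)
      (Metric.ball (0 : TangentSpace (𝓡 m) a) r) :=
  ha.2.2.2.2.2.1

variable [IsManifold (𝓡 m) ∞ M]

/-- The local approximations have positive derivative in a direction of linear growth. -/
theorem IsConvexRadius.eventually_localApprox {F : M → ℝ} {p : M}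
    {v Y : EuclideanSpace ℝ (Fin m)} {c R : ℝ} {L : ℝ≥0} (hc : 0 < c)
    (hlip : LipschitzOnWith L (fun z ↦ F ((extChartAt (𝓡 m) p).symm z)) (Metric.ball Y R))
    (hinc : ∀ y s, 0 ≤ s → y ∈ Metric.ball Y R → y + s • v ∈ Metric.ball Y R →
      c * s ≤ F ((extChartAt (𝓡 m) p).symm (y + s • v)) - F ((extChartAt (𝓡 m) p).symm y))
    {a : M} {r : ℝ} (ha : IsConvexRadius m a r) {y₁ : EuclideanSpace ℝ (Fin m)}
    (hy₁ : y₁ ∈ Metric.ball Y R) (hy₁t : y₁ ∈ (extChartAt (𝓡 m) p).target)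
    (hy₁a : (extChartAt (𝓡 m) p).symm y₁ ∈ Metric.eball a (ENNReal.ofReal r)) {η : ℝ}
    (hη : 0 < η) :
    ∀ᶠ x : ℝ × EuclideanSpace ℝ (Fin m) in 𝓝[>] 0 ×ˢ 𝓝 y₁,
      DifferentiableAt ℝ (fun y ↦ localApprox m F a r x.1 ((extChartAt (𝓡 m) p).symm y)) x.2 ∧
      c / 2 ≤ fderiv ℝ (fun y ↦ localApprox m F a r x.1 ((extChartAt (𝓡 m) p).symm y)) x.2 v ∧
      |localApprox m F a r x.1 ((extChartAt (𝓡 m) p).symm x.2)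
        - F ((extChartAt (𝓡 m) p).symm x.2)| ≤ η := by
  have hsymm : ContMDiffAt (𝓡 m) (𝓡 m) ∞ (extChartAt (𝓡 m) p).symm y₁ :=
    (contMDiffOn_extChartAt_symm (n := ∞) p).contMDiffAt
      ((isOpen_extChartAt_target p).mem_nhds hy₁t)
  -- `θ` passes from the chart at `p` to normal coordinates at `a`, and `κ` passes back; the
  -- mollification takes place in the latter.
  set θ : EuclideanSpace ℝ (Fin m) → TangentSpace (𝓡 m) a :=
    fun y ↦ expInv m a r ((extChartAt (𝓡 m) p).symm y) with hθ
  set κ : TangentSpace (𝓡 m) a → EuclideanSpace ℝ (Fin m) :=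
    fun z ↦ extChartAt (𝓡 m) p (expMap a z) with hκ
  have hθs : ContDiffAt ℝ 1 θ y₁ := by
    have h1 := ha.contMDiffOn_expInv.contMDiffAt (Metric.isOpen_eball.mem_nhds hy₁a)
    exact ((h1.comp y₁ hsymm).contDiffAt).of_le (by simp)
  have hθm : θ y₁ ∈ Metric.ball 0 r := ha.expInv_mem hy₁a
  have hexp : expMap a (θ y₁) = (extChartAt (𝓡 m) p).symm y₁ := ha.expMap_expInv hy₁a
  have hexps : ContMDiffAt 𝓘(ℝ, TangentSpace (𝓡 m) a) (𝓡 m) ∞ (expMap a) (θ y₁) :=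
    ha.contMDiffOn_expMap.contMDiffAt (Metric.isOpen_ball.mem_nhds hθm)
  have hsrc : expMap a (θ y₁) ∈ (extChartAt (𝓡 m) p).source := by
    rw [hexp]
    exact (extChartAt (𝓡 m) p).map_target hy₁t
  have hκs : ContDiffAt ℝ 1 κ (θ y₁) := by
    have h1 : ContMDiffAt (𝓡 m) (𝓡 m) ∞ (extChartAt (𝓡 m) p) (expMap a (θ y₁)) :=
      contMDiffAt_extChartAt' (by rwa [extChartAt_source] at hsrc)
    exact ((h1.comp (θ y₁) hexps).contDiffAt).of_le (by simp)
  have hκθ : ∀ᶠ y in 𝓝 y₁, κ (θ y) = y := by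
    filter_upwards [(isOpen_extChartAt_target p).mem_nhds hy₁t,
      hsymm.continuousAt.eventually_mem (Metric.isOpen_eball.mem_nhds hy₁a)] with y hy hya
    simp only [hκ, hθ]
    rw [ha.expMap_expInv hya, (extChartAt (𝓡 m) p).right_inv hy]
  have hh : ∀ᶠ z in 𝓝 (θ y₁), F (expMap a z) = F ((extChartAt (𝓡 m) p).symm (κ z)) := by
    filter_upwards [hexps.continuousAt.eventually_mem
      ((isOpen_extChartAt_source p).mem_nhds hsrc)] with z hz
    rw [hκ, (extChartAt (𝓡 m) p).left_inv hz]
  exact eventually_mollification (μ := (volume : Measure (TangentSpace (𝓡 m) a))) hc hlip hinc hy₁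
    hθs hκs hκθ hh (fun ε _ ↦ contDiff_mollifier a ε)
    (fun ε hε u hu ↦ mollifier_eq_zero a hε hu) (fun ε hε u ↦ mollifier_nonneg a hε u)
    (fun ε hε ↦ integral_mollifier a hε) hη

/-- A function whose expression in a chart has nonzero derivative has nonzero differential. -/
theorem differential_ne_zero {G : M → ℝ} {p q : M} (hq : q ∈ (extChartAt (𝓡 m) p).source)
    (hG : DifferentiableAt ℝ (fun y ↦ G ((extChartAt (𝓡 m) p).symm y)) (extChartAt (𝓡 m) p q))
    {v : EuclideanSpace ℝ (Fin m)}
    (hv : fderiv ℝ (fun y ↦ G ((extChartAt (𝓡 m) p).symm y)) (extChartAt (𝓡 m) p q) v ≠ 0) :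
    differential m G q ≠ 0 := by
  have hmd : MDifferentiableAt (𝓡 m) 𝓘(ℝ, ℝ) G q := by
    have h1 : MDifferentiableAt (𝓡 m) 𝓘(ℝ, ℝ)
        (fun q ↦ G ((extChartAt (𝓡 m) p).symm (extChartAt (𝓡 m) p q))) q :=
      hG.mdifferentiableAt.comp q
        (mdifferentiableAt_extChartAt (by rwa [extChartAt_source] at hq))
    refine h1.congr_of_eventuallyEq ?_
    filter_upwards [(isOpen_extChartAt_source p).mem_nhds hq] with q' hq'
    rw [(extChartAt (𝓡 m) p).left_inv hq']
  obtain ⟨y, hy, rfl⟩ : ∃ y ∈ (extChartAt (𝓡 m) p).target, (extChartAt (𝓡 m) p).symm y = q :=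
    ⟨_, (extChartAt (𝓡 m) p).map_source hq, (extChartAt (𝓡 m) p).left_inv hq⟩
  rw [(extChartAt (𝓡 m) p).right_inv hy, (hasFDerivAt_comp_extChartAt_symm hy hmd).fderiv] at hv
  intro h0
  rw [h0] at hv
  exact hv rfl

/-- Near a point of the domain of linear growth, the differentials of the global approximations do
not vanish. -/
theorem ApproxData.eventually_differential_ne_zero (D : ApproxData m M) {F : M → ℝ} {p : M}
    {v Y : EuclideanSpace ℝ (Fin m)} {c R : ℝ} {L : ℝ≥0} (hc : 0 < c)
    (hlip : LipschitzOnWith L (fun z ↦ F ((extChartAt (𝓡 m) p).symm z)) (Metric.ball Y R))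
    (hinc : ∀ y s, 0 ≤ s → y ∈ Metric.ball Y R → y + s • v ∈ Metric.ball Y R →
      c * s ≤ F ((extChartAt (𝓡 m) p).symm (y + s • v)) - F ((extChartAt (𝓡 m) p).symm y))
    {q₀ : M} (hq₀ : q₀ ∈ (extChartAt (𝓡 m) p).source)
    (hq₀Y : extChartAt (𝓡 m) p q₀ ∈ Metric.ball Y R) :
    ∀ᶠ x : ℝ × M in 𝓝[>] 0 ×ˢ 𝓝 q₀, differential m (D.globalApprox F x.1) x.2 ≠ 0 := by
  classical
  set y₁ := extChartAt (𝓡 m) p q₀ with hy₁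
  have hy₁t : y₁ ∈ (extChartAt (𝓡 m) p).target := (extChartAt (𝓡 m) p).map_source hq₀
  have hy₁q : (extChartAt (𝓡 m) p).symm y₁ = q₀ := (extChartAt (𝓡 m) p).left_inv hq₀
  have hsymm : ContMDiffAt (𝓡 m) (𝓡 m) ∞ (extChartAt (𝓡 m) p).symm y₁ :=
    (contMDiffOn_extChartAt_symm (n := ∞) p).contMDiffAt
      ((isOpen_extChartAt_target p).mem_nhds hy₁t)
  -- Other indices are discarded because `q₀` may lie outside their balls, where `localApprox` is
  -- meaningless; their `ψ i` vanish near `q₀`.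
  set I : Finset (Fin D.k) := Finset.univ.filter fun i ↦ q₀ ∈ tsupport (D.ψ i) with hI
  have hzero : ∀ᶠ y in 𝓝 y₁, ∀ i ∉ I, D.ψ i ((extChartAt (𝓡 m) p).symm y) = 0 := by
    rw [Filter.eventually_all]
    intro i
    by_cases hi : i ∈ I
    · exact Eventually.of_forall fun y h ↦ absurd hi h
    · have h1 : (extChartAt (𝓡 m) p).symm y₁ ∈ (tsupport (D.ψ i))ᶜ := by
        rw [hy₁q]
        simpa [hI] using hi
      filter_upwards [hsymm.continuousAt.eventually_mem
        ((isClosed_tsupport _).isOpen_compl.mem_nhds h1)] with y hy _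
      exact image_eq_zero_of_notMem_tsupport hy
  have hsum : ∀ᶠ y in 𝓝 y₁, ∑ i ∈ I, D.ψ i ((extChartAt (𝓡 m) p).symm y) = 1 := by
    filter_upwards [hzero] with y hy
    have h1 := D.ψ.sum_eq_one (mem_univ ((extChartAt (𝓡 m) p).symm y))
    rw [finsum_eq_sum_of_fintype] at h1
    rw [← h1]
    exact Finset.sum_subset (Finset.subset_univ I) fun i _ hi ↦ hy i hi
  have hmain := eventually_pos_fderiv_sum I
    (ψ := fun i y ↦ D.ψ i ((extChartAt (𝓡 m) p).symm y))
    (f := fun z ↦ F ((extChartAt (𝓡 m) p).symm z))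
    (g := fun i ε y ↦ localApprox m F (D.center i) (D.radius i) ε ((extChartAt (𝓡 m) p).symm y))
    (y₁ := y₁) (v := v) (half_pos hc)
    (fun i _ ↦ (((D.ψ i).contMDiff.contMDiffAt.comp y₁ hsymm).contDiffAt).of_le (by simp))
    (fun i _ y ↦ D.ψ.nonneg i _) hsum
    (fun i hi η hη ↦ (D.convexRadius i).eventually_localApprox hc hlip hinc hq₀Y hy₁t
      (by
        rw [hy₁q]
        exact D.subordinate i (Finset.mem_filter.1 hi).2) hη)
  have hlocal : ∀ᶠ x : ℝ × EuclideanSpace ℝ (Fin m) in 𝓝[>] 0 ×ˢ 𝓝 y₁,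
      DifferentiableAt ℝ (fun y ↦ D.globalApprox F x.1 ((extChartAt (𝓡 m) p).symm y)) x.2 ∧
      fderiv ℝ (fun y ↦ D.globalApprox F x.1 ((extChartAt (𝓡 m) p).symm y)) x.2 v ≠ 0 := by
    filter_upwards [hmain, hzero.eventually_nhds.prod_inr (𝓝[>] 0)] with ⟨ε, y⟩ h1 h2
    simp only at h1 h2 ⊢
    have h3 : (fun y ↦ D.globalApprox F ε ((extChartAt (𝓡 m) p).symm y)) =ᶠ[𝓝 y]
        fun y ↦ ∑ i ∈ I, D.ψ i ((extChartAt (𝓡 m) p).symm y) *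
          localApprox m F (D.center i) (D.radius i) ε ((extChartAt (𝓡 m) p).symm y) := by
      filter_upwards [h2] with y' hy'
      refine (Finset.sum_subset (Finset.subset_univ I) fun i _ hi ↦ ?_).symm
      rw [hy' i hi, zero_mul]
    rw [h3.differentiableAt_iff, h3.fderiv_eq]
    exact ⟨h1.1, h1.2.ne'⟩
  have hcont : Tendsto (fun x : ℝ × M ↦ (x.1, extChartAt (𝓡 m) p x.2)) (𝓝[>] 0 ×ˢ 𝓝 q₀)
      (𝓝[>] 0 ×ˢ 𝓝 y₁) :=
    Tendsto.prodMap tendsto_id (continuousAt_extChartAt' hq₀)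
  have hsrc : ∀ᶠ q in 𝓝 q₀, q ∈ (extChartAt (𝓡 m) p).source :=
    (isOpen_extChartAt_source p).mem_nhds hq₀
  filter_upwards [hcont.eventually hlocal, hsrc.prod_inr (𝓝[>] 0)] with ⟨ε, q⟩ h1 h2
  exact differential_ne_zero h2 h1.1 h1.2

end GlobalApproximation

end LipApprox

end

/-! ### Choice of the radius and uniformity in `ε` -/

theorem corollary1p6 {m : ℕ} (hm : 1 ≤ m) {M : Type*} [EMetricSpace M] [CompactSpace M]
    [ChartedSpace (EuclideanSpace ℝ (Fin m)) M] [IsManifold (𝓡 m) ∞ M]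
    [RiemannianBundle (fun x : M ↦ TangentSpace (𝓡 m) x)]
    [IsContMDiffRiemannianBundle (𝓡 m) ∞ (EuclideanSpace ℝ (Fin m))
      (fun x : M ↦ TangentSpace (𝓡 m) x)]
    [IsRiemannianManifold (𝓡 m) M]
    (F : M → ℝ) (hF : ∃ L : ℝ≥0, LipschitzWith L F)
    (p : M) (hp : LipApprox.IsClarkeNonsingular m F p) :
    ∃ lam : ℝ, 0 < lam ∧ ∀ D : LipApprox.ApproxData m M,
      ∃ ε₀ : ℝ, 0 < ε₀ ∧ ENNReal.ofReal ε₀ ≤ LipApprox.injRadius m M / 2 ∧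
        ∀ ε ∈ Set.Ioo 0 ε₀, ∀ q ∈ Metric.eball p (ENNReal.ofReal lam),
          LipApprox.riemGrad m (D.globalApprox F ε) q ≠ 0 ∧
            ¬ LipApprox.IsCriticalPt m (D.globalApprox F ε) q := by
  obtain ⟨L, hL⟩ := hF
  obtain ⟨v, c, R, L', hc, hR, -, hlip, hinc⟩ := hp.exists_increment hm hL
  have hU : ∀ᶠ q in 𝓝 p, q ∈ (extChartAt (𝓡 m) p).source ∧
      extChartAt (𝓡 m) p q ∈ Metric.ball (extChartAt (𝓡 m) p p) R :=
    Filter.Eventually.and (extChartAt_source_mem_nhds (I := 𝓡 m) p)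
      ((continuousAt_extChartAt p).eventually_mem (Metric.ball_mem_nhds _ hR))
  obtain ⟨δ, hδ, hδs⟩ := Metric.nhds_basis_eball.mem_iff.1 hU
  -- Strictly below `δ`, so that the closed ball, compact since `M` is, still lies in the region of
  -- growth; the cover has not entered yet.
  obtain ⟨lam, hlam0, hlam⟩ := ENNReal.lt_iff_exists_real_btwn.1 hδ
  have hlampos : 0 < lam := ENNReal.ofReal_pos.1 hlam.1
  refine ⟨lam, hlampos, fun D ↦ ?_⟩
  have hcpt : IsCompact (Metric.closedEBall p (ENNReal.ofReal lam)) :=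
    Metric.isClosed_closedEBall.isCompact
  -- Tube lemma: the local statements, joint in `ε` and the point, give one bound on `ε` for the
  -- whole closed ball.
  have hev := hcpt.eventually_forall_of_forall_eventually (x₀ := (0 : ℝ))
    (P := fun ε q ↦ 0 < ε → LipApprox.differential m (D.globalApprox F ε) q ≠ 0) (fun q hq ↦ by
      have hq' : q ∈ Metric.eball p δ := lt_of_le_of_lt hq hlam.2
      obtain ⟨h1, h2⟩ := hδs hq'
      have h3 := D.eventually_differential_ne_zero hc hlip hinc h1 h2
      rw [← nhdsWithin_univ q, ← nhdsWithin_prod_eq, eventually_nhdsWithin_iff] at h3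
      filter_upwards [h3] with x hx hx0
      exact hx ⟨hx0, mem_univ _⟩)
  obtain ⟨ε₁, hε₁, hε₁s⟩ := Metric.mem_nhds_iff.1 hev
  -- A ball of the cover containing `p` has a positive radius below half the injectivity radius,
  -- which serves as a cap for `ε₀`.
  obtain ⟨i, -⟩ := mem_iUnion.1 (D.cover.symm ▸ mem_univ p :
    p ∈ ⋃ i, Metric.eball (D.center i) (ENNReal.ofReal (D.radius i)))
  refine ⟨min ε₁ (D.radius i), lt_min hε₁ (D.convexRadius i).1,
    (ENNReal.ofReal_le_ofReal (min_le_right _ _)).trans (D.radius_lt i).le, fun ε hε q hq ↦ ?_⟩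
  have hne : LipApprox.differential m (D.globalApprox F ε) q ≠ 0 := by
    refine hε₁s ?_ q (Metric.eball_subset_closedEBall hq) hε.1
    rw [mem_ball_zero_iff, Real.norm_of_nonneg hε.1.le]
    exact hε.2.trans_le (min_le_left _ _)
  refine ⟨fun h0 ↦ hne ?_, hne⟩
  rw [LipApprox.riemGrad] at h0
  exact (LinearIsometryEquiv.map_eq_zero_iff _).1 h0
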